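/- Let $\mathbb K=\mathbb R$ or $\mathbb C$, let $\Omega\subseteq\mathbb K^n$ be open, and let $P^{ij}=\partial_x\,g^{ij}(u)\,\partial_x$ be a non-degenerate second-order homogeneous Hamiltonian operator on $\Omega$ (in flat coordinates): $g^{ij}$ is smooth on $\Omega$, $\det(g^{ij})\neq0$, $P$ is formally skew-adjoint and satisfies the Jacobi identity, i.e. $\{F,G\}=\int\frac{\delta F}{\delta u^i}P^{ij}\frac{\delta G}{\delta u^j}\,dx$ is a Poisson bracket. Let $V:\Omega\to\mathbb K^n$ be smooth and suppose that the first-order quasilinear system of conservation laws $$u^i_t=(V^i(u))_x=V^i_j(u)\,u^j_x,\qquad V^i_j=\frac{\partial V^i}{\partial u^j},\quad i=1,\dots,n,$$ is compatible with $P$, i.e. $P$ is invariant under the flow of the system: $P'_u[(V(u))_x]=\ell\circ P+P\circ\ell^*$ for all fields $u(x)$ with values in $\Omega$, where $\ell\varphi=\partial_x(V^i_j(u)\varphi^j)$ is the linearization of the right-hand side, $\ell^*$ is its formal adjoint, and $P'_u[\eta]^{ij}=\partial_x\,\frac{\partial g^{ij}}{\partial u^k}(u)\,\eta^k\,\partial_x$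 is the derivative of $P$ along $\eta$. Then the system is linearly degenerate: if $U\subseteq\Omega$ is open, $\lambda:U\to\mathbb C$ is of class $C^1$ over $\mathbb K$, $r:U\to\mathbb C^n$ is continuous and nowhere zero, and $V^i_j\,r^j=\lambda\,r^i$ on $U$, then $$\sum_{i=1}^n r^i\,\frac{\partial\lambda}{\partial u^i}=0\quad\text{on }U.$$ -/

import Mathlib

open scoped Matrix ContDiff
open MeasureTheory

noncomputable section

namespace HHO

/-!
Throughout, `𝕜` is `ℝ` or `ℂ`, the field variables `u = (u¹, …, uⁿ)` take values in
`Fin n → 𝕜`, and they depend on one real space variable `x`.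
-/

variable {𝕜 : Type*} [RCLike 𝕜] {n : ℕ}

/-- The second-order homogeneous operator `P = ∂ₓ ∘ g ∘ ∂ₓ` with (contravariant) leading
coefficient `g = (gⁱʲ(u))`, evaluated on the field `u` and applied to the covector `ψ`:
`(P_u ψ)ⁱ = ∂ₓ (gⁱʲ(u) ∂ₓ ψⱼ)`. -/
def op (g : (Fin n → 𝕜) → Matrix (Fin n) (Fin n) 𝕜) (u ψ : ℝ → Fin n → 𝕜) :
    ℝ → Fin n → 𝕜 :=
  deriv fun x => g (u x) *ᵥ deriv ψ x

/-- The derivative of the matrix function `g` at the point `v` in the direction `η`: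
the matrix with entries `(∂gⁱʲ/∂uᵏ)(v) ηᵏ`. -/
def coeffDeriv (g : (Fin n → 𝕜) → Matrix (Fin n) (Fin n) 𝕜) (v η : Fin n → 𝕜) :
    Matrix (Fin n) (Fin n) 𝕜 :=
  Matrix.of fun i j => fderiv 𝕜 (fun w => g w i j) v η

/-- The derivative of the operator `P = ∂ₓ ∘ g ∘ ∂ₓ` with respect to the field `u` along the
evolutionary vector field `η`: `(P'_u[η] ψ)ⁱ = ∂ₓ ((∂gⁱʲ/∂uᵏ)(u) ηᵏ ∂ₓ ψⱼ)`. -/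
def opDeriv (g : (Fin n → 𝕜) → Matrix (Fin n) (Fin n) 𝕜) (u η ψ : ℝ → Fin n → 𝕜) :
    ℝ → Fin n → 𝕜 :=
  deriv fun x => coeffDeriv g (u x) (η x) *ᵥ deriv ψ x

/-- `ψ` is a smooth, compactly supported covector-valued function of `x`. -/
def IsTest (ψ : ℝ → Fin n → 𝕜) : Prop :=
  ContDiff ℝ ∞ ψ ∧ HasCompactSupport ψ

/-- `P = ∂ₓ ∘ g ∘ ∂ₓ` is a non-degenerate second-order homogeneous Hamiltonian operator on the
domain `Ω` of field values: `g` is smooth and invertible on `Ω`, the operator is formally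
skew-adjoint, and it satisfies the Jacobi identity, that is, the bracket
`{F, G} = ∫ (δF/δuⁱ) Pⁱʲ (δG/δuʲ) dx` is a Poisson bracket. -/
structure IsSecondOrderHHO (g : (Fin n → 𝕜) → Matrix (Fin n) (Fin n) 𝕜)
    (Ω : Set (Fin n → 𝕜)) : Prop where
  smooth : ∀ i j, ContDiffOn 𝕜 ∞ (fun u => g u i j) Ω
  nondegenerate : ∀ u ∈ Ω, (g u).det ≠ 0
  skewAdjoint : ∀ u : ℝ → Fin n → 𝕜, ContDiff ℝ ∞ u → (∀ x, u x ∈ Ω) →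
    ∀ ψ₁ ψ₂ : ℝ → Fin n → 𝕜, IsTest ψ₁ → IsTest ψ₂ →
      ∫ x, ψ₁ x ⬝ᵥ op g u ψ₂ x = -∫ x, ψ₂ x ⬝ᵥ op g u ψ₁ x
  jacobi : ∀ u : ℝ → Fin n → 𝕜, ContDiff ℝ ∞ u → (∀ x, u x ∈ Ω) →
    ∀ ψ₁ ψ₂ ψ₃ : ℝ → Fin n → 𝕜, IsTest ψ₁ → IsTest ψ₂ → IsTest ψ₃ →
      ∫ x, (ψ₁ x ⬝ᵥ opDeriv g u (op g u ψ₂) ψ₃ x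
          + ψ₂ x ⬝ᵥ opDeriv g u (op g u ψ₃) ψ₁ x
          + ψ₃ x ⬝ᵥ opDeriv g u (op g u ψ₁) ψ₂ x) = 0

/-- The matrix `(Vⁱⱼ) = (∂Vⁱ/∂uʲ)` of the quasilinear system `uⁱ_t = (Vⁱ(u))ₓ = Vⁱⱼ(u) uʲₓ`. -/
def velocityMatrix (V : (Fin n → 𝕜) → Fin n → 𝕜) (u : Fin n → 𝕜) :
    Matrix (Fin n) (Fin n) 𝕜 :=
  Matrix.of fun i j => fderiv 𝕜 V u (Pi.single j 1) i

/-- The right-hand side `(V(u))ₓ` of the system of conservation laws `u_t = (V(u))ₓ`. -/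
def flow (V : (Fin n → 𝕜) → Fin n → 𝕜) (u : ℝ → Fin n → 𝕜) : ℝ → Fin n → 𝕜 :=
  deriv fun x => V (u x)

/-- The linearization `ℓ` of `u ↦ (V(u))ₓ` at the field `u`: `(ℓ φ)ⁱ = ∂ₓ (Vⁱⱼ(u) φʲ)`. -/
def linearization (V : (Fin n → 𝕜) → Fin n → 𝕜) (u φ : ℝ → Fin n → 𝕜) :
    ℝ → Fin n → 𝕜 :=
  deriv fun x => velocityMatrix V (u x) *ᵥ φ x

/-- The formal adjoint `ℓ*` of the linearization: `(ℓ* ψ)ⱼ = -Vⁱⱼ(u) ∂ₓ ψᵢ`. -/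
def linearizationAdjoint (V : (Fin n → 𝕜) → Fin n → 𝕜) (u ψ : ℝ → Fin n → 𝕜) :
    ℝ → Fin n → 𝕜 :=
  fun x => -((velocityMatrix V (u x))ᵀ *ᵥ deriv ψ x)

/-- The system of conservation laws `u_t = (V(u))ₓ` is compatible with the operator
`P = ∂ₓ ∘ g ∘ ∂ₓ`: the operator is invariant under the flow of the system,
`P'_u[(V(u))ₓ] = ℓ ∘ P + P ∘ ℓ*`. Equivalently, on solutions `u` of the system `P` maps the
solutions `ψ` of the adjoint linearized system `ψ_t = -ℓ* ψ` to solutions `φ = P ψ` of the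
linearized system `φ_t = ℓ φ`. -/
def IsCompatible (g : (Fin n → 𝕜) → Matrix (Fin n) (Fin n) 𝕜)
    (V : (Fin n → 𝕜) → Fin n → 𝕜) (Ω : Set (Fin n → 𝕜)) : Prop :=
  ∀ u ψ : ℝ → Fin n → 𝕜, ContDiff ℝ ∞ u → ContDiff ℝ ∞ ψ → ∀ x, u x ∈ Ω →
    opDeriv g u (flow V u) ψ x =
      linearization V u (op g u ψ) x + op g u (linearizationAdjoint V u ψ) x

/-- The system `uⁱ_t = Vⁱⱼ(u) uʲₓ`, `Vⁱⱼ = ∂Vⁱ/∂uʲ`, is linearly degenerate on `Ω`: every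
characteristic speed is constant along its characteristic directions. That is, whenever on an
open set `U ⊆ Ω` a `C¹` function `lam` is an eigenvalue of `(Vⁱⱼ)` with a continuous field of
eigenvectors `r`, then `rⁱ ∂lam/∂uⁱ = 0` on `U`. Eigenvalues and eigenvectors may be complex,
also when `𝕜 = ℝ`, and eigenvalues may be multiple. -/
def IsLinearlyDegenerate [NormedAlgebra 𝕜 ℂ] (V : (Fin n → 𝕜) → Fin n → 𝕜)
    (Ω : Set (Fin n → 𝕜)) : Prop :=
  ∀ U : Set (Fin n → 𝕜), IsOpen U → U ⊆ Ω →
    ∀ (lam : (Fin n → 𝕜) → ℂ) (r : (Fin n → 𝕜) → Fin n → ℂ),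
      ContDiffOn 𝕜 1 lam U → ContinuousOn r U →
      (∀ u ∈ U, r u ≠ 0 ∧
        (velocityMatrix V u).map (algebraMap 𝕜 ℂ) *ᵥ r u = lam u • r u) →
      ∀ u ∈ U, ∑ i, r u i * fderiv 𝕜 lam u (Pi.single i 1) = 0

end HHO

end

/-! Write h = g⁻¹ and W = (Vⁱⱼ). Testing skew-adjointness and the Jacobi identity on constant fields
makes h skew and Tᵢⱼₖ = ∂ₖhᵢⱼ cyclic, hence totally skew (`torsion_swap`, `torsion_cyclic`). Since
∂ₗTᵢⱼₖ is also symmetric in k, l, it vanishes (`fderiv_torsion`): h is affine on balls.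
Compatibility yields Wg = gWᵀ and one relation between the derivatives of g and W. With the skewness
of T these give hV = f + A(u - v) and hW = A - T(·, V, ·) near v (`exists_affine`), so V is a
rational function there.

Let Wr = cr at v. Because T(·, r, r) = 0, the affine function V(v) + ctr solves the linear system
for V on the line v + tr, and r remains an eigenvector with the same speed c. For a real direction
and a simple eigenvalue this already says that λ is constant along the line.

In general r may be complex while u is real, and λ may be multiple. So one works with det(h)ⁿ⁺¹
det(c - W), which is a polynomial in u - v (`det_pencil_eq`) and vanishes on the possibly complex
line through v in direction r (`det_pencil_line_eq_zero`). Let v minimize the multiplicity m of λ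
and take c = λ(v). Then det(c - W(u)) = (λ(v) - λ(u))ᵐ q(u) with q(v) ≠ 0, so along v + sz the
coefficient of sᵐ is a nonzero multiple of (dλ(z))ᵐ. This is an identity of polynomials in z, so z =
r may be substituted, and the coefficient is zero there. Hence rⁱ∂ᵢλ vanishes at some point of every
nonempty open subset of U, and by continuity everywhere (`exists_mem_fderiv_eq_zero`). -/

namespace HHO

/-! ### Algebraic consequences of skew-adjointness and Jacobi on constant fields -/

section TestFunctions

variable {𝕜 : Type*} [RCLike 𝕜] {n : ℕ}

theorem hasDerivAt_of_contDiff {E : Type*} [NormedAddCommGroup E] [NormedSpace ℝ E] {f : ℝ → E}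
    (hf : ContDiff ℝ ∞ f) (x : ℝ) : HasDerivAt f (deriv f x) x :=
  (hf.differentiable (by simp) x).hasDerivAt

theorem contDiff_deriv {E : Type*} [NormedAddCommGroup E] [NormedSpace ℝ E] {f : ℝ → E}
    (hf : ContDiff ℝ ∞ f) : ContDiff ℝ ∞ (deriv f) :=
  (contDiff_infty_iff_deriv.1 hf).2

/-- Integration by parts against a smooth compactly supported function. -/
theorem integral_mul_deriv_of_hasCompactSupport {φ f : ℝ → 𝕜} (hφ : ContDiff ℝ ∞ φ)
    (hc : HasCompactSupport φ) (hf : ContDiff ℝ ∞ f) :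
    ∫ x, φ x * deriv f x = -∫ x, deriv φ x * f x := by
  have hf' := contDiff_deriv hf
  have hφ' := contDiff_deriv hφ
  apply integral_mul_deriv_eq_deriv_mul_of_integrable
  · exact fun x _ => hasDerivAt_of_contDiff hφ x
  · exact fun x _ => hasDerivAt_of_contDiff hf x
  · exact (hφ.continuous.mul hf'.continuous).integrable_of_hasCompactSupport hc.mul_right
  · exact (hφ'.continuous.mul hf.continuous).integrable_of_hasCompactSupport hc.deriv.mul_right
  · exact (hφ.continuous.mul hf.continuous).integrable_of_hasCompactSupport hc.mul_right

theorem isTest_smul_const {φ : ℝ → 𝕜} (hφ : ContDiff ℝ ∞ φ) (hc : HasCompactSupport φ)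
    (e : Fin n → 𝕜) : IsTest fun x => φ x • e :=
  ⟨hφ.smul contDiff_const, hc.smul_right⟩

theorem deriv_smul_const_vec {φ : ℝ → 𝕜} (hφ : ContDiff ℝ ∞ φ) (e : Fin n → 𝕜) :
    (deriv fun x => φ x • e) = fun x => deriv φ x • e := by
  ext1 x
  exact ((hasDerivAt_of_contDiff hφ x).smul_const e).deriv

theorem op_const (g : (Fin n → 𝕜) → Matrix (Fin n) (Fin n) 𝕜) (v e : Fin n → 𝕜) {φ : ℝ → 𝕜}
    (hφ : ContDiff ℝ ∞ φ) :
    op g (fun _ => v) (fun x => φ x • e) = fun x => deriv (deriv φ) x • (g v *ᵥ e) := by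
  unfold op
  rw [deriv_smul_const_vec hφ]
  simp only [Matrix.mulVec_smul]
  exact deriv_smul_const_vec (contDiff_deriv hφ) _

theorem coeffDeriv_smul (g : (Fin n → 𝕜) → Matrix (Fin n) (Fin n) 𝕜) (v : Fin n → 𝕜) (c : 𝕜)
    (w : Fin n → 𝕜) : coeffDeriv g v (c • w) = c • coeffDeriv g v w := by
  ext i j
  simp [coeffDeriv]

theorem opDeriv_const (g : (Fin n → 𝕜) → Matrix (Fin n) (Fin n) 𝕜) (v w e : Fin n → 𝕜)
    {φ χ : ℝ → 𝕜} (hφ : ContDiff ℝ ∞ φ) (hχ : ContDiff ℝ ∞ χ) :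
    opDeriv g (fun _ => v) (fun x => χ x • w) (fun x => φ x • e) =
      fun x => deriv (fun y => χ y * deriv φ y) x • (coeffDeriv g v w *ᵥ e) := by
  unfold opDeriv
  rw [deriv_smul_const_vec hφ]
  simp only [Matrix.mulVec_smul, coeffDeriv_smul, Matrix.smul_mulVec, smul_smul]
  rw [← deriv_smul_const_vec (hχ.mul (contDiff_deriv hφ))]
  simp only [mul_comm]

/-- φ is a bump and χ is x²/2 cut off outside a neighbourhood of the support of φ, so that χ'' = 1
wherever φ' ≠ 0. -/
theorem exists_contDiff_hasCompactSupport_integral_ne_zero :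
    ∃ φ χ : ℝ → 𝕜, ContDiff ℝ ∞ φ ∧ HasCompactSupport φ ∧ ContDiff ℝ ∞ χ ∧ HasCompactSupport χ ∧
      (∫ x, deriv φ x * deriv φ x ≠ 0) ∧
      (∫ x, deriv φ x * deriv φ x * deriv (deriv χ) x = ∫ x, deriv φ x * deriv φ x) := by
  let b : ContDiffBump (0 : ℝ) := ⟨1, 2, by norm_num, by norm_num⟩
  let b' : ContDiffBump (0 : ℝ) := ⟨3, 4, by norm_num, by norm_num⟩
  have hb : ContDiff ℝ ∞ (b : ℝ → ℝ) := b.contDiff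
  have hb' : ContDiff ℝ ∞ (b' : ℝ → ℝ) := b'.contDiff
  have hbd := contDiff_deriv hb
  have hp : ContDiff ℝ ∞ (fun x : ℝ => x ^ 2 / 2) := by fun_prop
  have hof : ContDiff ℝ ∞ (fun x : ℝ => (x : 𝕜)) := (RCLike.ofRealCLM (K := 𝕜)).contDiff
  have hd : ∀ f : ℝ → ℝ, ContDiff ℝ ∞ f →
      (deriv fun x => ((f x : ℝ) : 𝕜)) = fun x => ((deriv f x : ℝ) : 𝕜) := by
    intro f hf
    ext1 x
    exact ((RCLike.ofRealCLM (K := 𝕜)).hasFDerivAt.comp_hasDerivAt x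
      (hasDerivAt_of_contDiff hf x)).deriv
  have hχ := hb'.mul hp
  refine ⟨fun x => (b x : 𝕜), fun x => ((b' x * (x ^ 2 / 2) : ℝ) : 𝕜), hof.comp hb,
    b.hasCompactSupport.comp_left (g := fun x : ℝ => (x : 𝕜)) (by simp), hof.comp hχ,
    (b'.hasCompactSupport.mul_right (f' := fun x : ℝ => x ^ 2 / 2)).comp_left
      (g := fun x : ℝ => (x : 𝕜)) (by simp), ?_, ?_⟩
  · rw [hd _ hb]
    simp only [← RCLike.ofReal_mul]
    rw [integral_ofReal]
    obtain ⟨x, hx⟩ : ∃ x, deriv b x ≠ 0 := by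
      by_contra! h
      have h1 : b 0 = 1 := b.one_of_mem_closedBall (by simp [b])
      have h2 : b 3 = 0 := b.zero_of_le_dist (by simp [b]; norm_num)
      have := is_const_of_deriv_eq_zero (hb.differentiable (by simp)) h 0 3
      rw [h1, h2] at this
      exact one_ne_zero this
    have := Continuous.integral_pos_of_hasCompactSupport_nonneg_nonzero (μ := volume)
      (hbd.continuous.mul hbd.continuous) (b.hasCompactSupport.deriv.mul_right)
      (fun x => mul_self_nonneg (deriv b x)) (mul_ne_zero hx hx)
    exact_mod_cast this.ne'
  · rw [hd _ hb, hd _ hχ, hd _ (contDiff_deriv hχ)]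
    congr 1
    ext1 x
    by_cases hx : x ∈ Metric.ball (0 : ℝ) 3
    · have h1 : (fun y => b' y * (y ^ 2 / 2)) =ᶠ[nhds x] fun y => y ^ 2 / 2 := by
        filter_upwards [Metric.isOpen_ball.mem_nhds hx] with y hy
        rw [b'.one_of_mem_closedBall (Metric.ball_subset_closedBall hy), one_mul]
      have h2 : deriv (fun y : ℝ => y ^ 2 / 2) = fun y => y := by
        ext1 y
        simp
      beta_reduce
      rw [h1.deriv.deriv_eq, h2]
      simp
    · have : deriv b x = 0 := by
        have : x ∉ tsupport b := by
          rw [b.tsupport_eq]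
          intro h
          exact hx (Metric.closedBall_subset_ball (by simp [b]; norm_num) h)
        by_contra h
        exact this (support_deriv_subset h)
      simp [this]

theorem matrix_apply_eq_dotProduct (M : Matrix (Fin n) (Fin n) 𝕜) (i j : Fin n) :
    Pi.single i 1 ⬝ᵥ (M *ᵥ Pi.single j 1) = M i j := by
  simp

variable {g : (Fin n → 𝕜) → Matrix (Fin n) (Fin n) 𝕜} {Ω : Set (Fin n → 𝕜)}

/-- On a constant field the pairing of φeᵢ with P(φeⱼ) is -gⁱʲ ∫ φ'², and the integral is nonzero.
-/
theorem IsSecondOrderHHO.transpose_eq_neg (hg : IsSecondOrderHHO g Ω) {v : Fin n → 𝕜}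
    (hv : v ∈ Ω) : (g v)ᵀ = -g v := by
  obtain ⟨φ, χ, hφ, hφc, -, -, h0, -⟩ :=
    exists_contDiff_hasCompactSupport_integral_ne_zero (𝕜 := 𝕜)
  ext i j
  have h := hg.skewAdjoint (fun _ => v) contDiff_const (fun _ => hv) _ _
    (isTest_smul_const hφ hφc (Pi.single i 1)) (isTest_smul_const hφ hφc (Pi.single j 1))
  have key : ∀ e f : Fin n → 𝕜, ∫ x, (φ x • e) ⬝ᵥ op g (fun _ => v) (fun x => φ x • f) x =
      -((e ⬝ᵥ (g v *ᵥ f)) * ∫ x, deriv φ x * deriv φ x) := by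
    intro e f
    rw [op_const g v f hφ]
    simp only [smul_dotProduct, dotProduct_smul, smul_eq_mul, mul_left_comm _ (φ _)]
    simp_rw [← mul_assoc]
    rw [integral_mul_const,
      integral_mul_deriv_of_hasCompactSupport hφ hφc (contDiff_deriv hφ)]
    ring
  rw [key, key, matrix_apply_eq_dotProduct, matrix_apply_eq_dotProduct] at h
  have h' : (g v i j + g v j i) * ∫ x, deriv φ x * deriv φ x = 0 := by linear_combination -h
  rw [Matrix.transpose_apply, Matrix.neg_apply]
  exact eq_neg_of_add_eq_zero_right ((mul_eq_zero.1 h').resolve_right h0)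

/-- On a constant field each Jacobi term is an entry of A = (∂ₖgⁱʲ) gᵏˡ times an integral ∫ φ₁' φ₂''
φ₃'. Using φ twice and χ once leaves a single independent integral, and hence a linear relation
among the three cyclic entries. -/
theorem IsSecondOrderHHO.coeffDeriv_cyclic (hg : IsSecondOrderHHO g Ω) {v : Fin n → 𝕜}
    (hv : v ∈ Ω) (i j l : Fin n) :
    coeffDeriv g v (g v *ᵥ Pi.single l 1) i j = coeffDeriv g v (g v *ᵥ Pi.single i 1) j l := by
  set A : Fin n → Fin n → Fin n → 𝕜 :=
    fun i j l => coeffDeriv g v (g v *ᵥ Pi.single l 1) i j with hA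
  obtain ⟨φ, χ, hφ, hφc, hχ, hχc, h0, h1⟩ :=
    exists_contDiff_hasCompactSupport_integral_ne_zero (𝕜 := 𝕜)
  rw [← h1] at h0
  have hφ' := contDiff_deriv hφ
  have hχ' := contDiff_deriv hχ
  have key : ∀ φ₁ φ₂ φ₃ : ℝ → 𝕜, ContDiff ℝ ∞ φ₁ → HasCompactSupport φ₁ → ContDiff ℝ ∞ φ₂ →
      ContDiff ℝ ∞ φ₃ → ∀ i j l : Fin n,
      (Integrable fun x => (φ₁ x • (Pi.single i 1 : Fin n → 𝕜)) ⬝ᵥ opDeriv g (fun _ => v)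
        (op g (fun _ => v) (fun x => φ₂ x • Pi.single l 1)) (fun x => φ₃ x • Pi.single j 1) x) ∧
      ∫ x, (φ₁ x • (Pi.single i 1 : Fin n → 𝕜)) ⬝ᵥ opDeriv g (fun _ => v)
        (op g (fun _ => v) (fun x => φ₂ x • Pi.single l 1)) (fun x => φ₃ x • Pi.single j 1) x =
      -(A i j l * ∫ x, deriv φ₁ x * (deriv (deriv φ₂) x * deriv φ₃ x)) := by
    intro φ₁ φ₂ φ₃ h₁ hc h₂ h₃ i j l
    have h₂'' := contDiff_deriv (contDiff_deriv h₂)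
    have h₃' := contDiff_deriv h₃
    rw [op_const g v _ h₂, opDeriv_const g v _ _ h₃ h₂'']
    simp only [smul_dotProduct, dotProduct_smul, smul_eq_mul, mul_left_comm _ (φ₁ _)]
    simp only [← mul_assoc (φ₁ _)]
    constructor
    · exact ((h₁.continuous.mul (contDiff_deriv (h₂''.mul h₃')).continuous).mul
        continuous_const).integrable_of_hasCompactSupport (μ := volume)
          hc.mul_right.mul_right
    · rw [integral_mul_const, integral_mul_deriv_of_hasCompactSupport h₁ hc (h₂''.mul h₃'),
        matrix_apply_eq_dotProduct]
      simp only [hA]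
      ring
  have hrel : ∀ i j l, A i j l + A j l i = 2 * A l i j := by
    intro i j l
    have h := hg.jacobi (fun _ => v) contDiff_const (fun _ => hv) _ _ _
      (isTest_smul_const hφ hφc (Pi.single i 1)) (isTest_smul_const hφ hφc (Pi.single l 1))
      (isTest_smul_const hχ hχc (Pi.single j 1))
    obtain ⟨i1, k1⟩ := key φ φ χ hφ hφc hφ hχ i j l
    obtain ⟨i2, k2⟩ := key φ χ φ hφ hφc hχ hφ l i j
    obtain ⟨i3, k3⟩ := key χ φ φ hχ hχc hφ hφ j l i
    erw [integral_add (i1.add i2) i3, integral_add i1 i2] at h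
    rw [k1, k2, k3] at h
    have hparts := integral_mul_deriv_of_hasCompactSupport (hφ'.mul hφ')
      hφc.deriv.mul_right hχ'
    have hd : (deriv fun x => deriv φ x * deriv φ x) =
        fun x => 2 * (deriv φ x * deriv (deriv φ) x) := by
      ext1 x
      refine ((hasDerivAt_of_contDiff hφ' x).mul (hasDerivAt_of_contDiff hφ' x)).deriv.trans ?_
      ring
    -- As φ'φ'' = (φ'²)'/2, the other two integrals are -1/2 times this one; this produces the
    -- coefficient 2 in `hrel`.
    have hparts' : ∫ x, deriv φ x * deriv φ x * deriv (deriv χ) x =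
        -(2 * ∫ x, deriv φ x * (deriv (deriv φ) x * deriv χ x)) := by
      rw [← integral_const_mul]
      refine hparts.trans ?_
      congr 1
      refine integral_congr_ae (.of_forall fun x => ?_)
      change deriv (fun x => deriv φ x * deriv φ x) x * deriv χ x = _
      rw [hd]
      ring
    have e2 : ∫ x, deriv φ x * (deriv (deriv χ) x * deriv φ x) =
        ∫ x, deriv φ x * deriv φ x * deriv (deriv χ) x := by
      congr 1
      ext1 x
      ring
    have e3 : ∫ x, deriv χ x * (deriv (deriv φ) x * deriv φ x) =
        ∫ x, deriv φ x * (deriv (deriv φ) x * deriv χ x) := by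
      congr 1
      ext1 x
      ring
    rw [e2, e3] at h
    have : (A i j l + A j l i - 2 * A l i j) *
        ∫ x, deriv φ x * deriv φ x * deriv (deriv χ) x = 0 := by
      linear_combination 2 * h + (A i j l + A j l i) * hparts'
    exact sub_eq_zero.1 ((mul_eq_zero.1 this).resolve_right h0)
  -- Two cyclic shifts of the relation; their difference is 3 (A i j l - A j l i) = 0.
  have h3 := hrel l i j
  have h4 := hrel j l i
  change A i j l = A j l i
  linear_combination (1 / 3 : 𝕜) * h3 - (1 / 3 : 𝕜) * h4

end TestFunctions

/-! ### Pointwise form of the compatibility condition -/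

section Compatibility

variable {𝕜 : Type*} [RCLike 𝕜] {n : ℕ}

theorem hasDerivAt_mulVec {M : ℝ → Matrix (Fin n) (Fin n) 𝕜} {M' : Matrix (Fin n) (Fin n) 𝕜}
    {a : ℝ → Fin n → 𝕜} {a' : Fin n → 𝕜} {x : ℝ}
    (hM : ∀ i j, HasDerivAt (fun y => M y i j) (M' i j) x) (ha : HasDerivAt a a' x) :
    HasDerivAt (fun y => M y *ᵥ a y) (M' *ᵥ a x + M x *ᵥ a') x := by
  rw [hasDerivAt_pi]
  intro i
  have := HasDerivAt.fun_sum (u := Finset.univ) fun j _ => (hM i j).mul (hasDerivAt_pi.1 ha j)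
  simpa [Matrix.mulVec, dotProduct, Finset.sum_add_distrib] using this

theorem hasDerivAt_matrix_comp {g : (Fin n → 𝕜) → Matrix (Fin n) (Fin n) 𝕜}
    {u : ℝ → Fin n → 𝕜} {ξ : Fin n → 𝕜} {x : ℝ}
    (hg : ∀ i j, DifferentiableAt 𝕜 (fun w => g w i j) (u x)) (hu : HasDerivAt u ξ x) (i j : Fin n) :
    HasDerivAt (fun y => g (u y) i j) (coeffDeriv g (u x) ξ i j) x :=
  ((hg i j).hasFDerivAt.restrictScalars ℝ).comp_hasDerivAt x hu

/-- Since p vanishes at 0, continuity of h suffices; no second derivatives of g or of the velocity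
matrix have to be computed. -/
theorem hasDerivAt_zero_smul {E : Type*} [NormedAddCommGroup E] [NormedSpace ℝ E] {p : ℝ → ℝ}
    {p' : ℝ} {h : ℝ → E} (hp : HasDerivAt p p' 0) (h0 : p 0 = 0) (hh : ContinuousAt h 0) :
    HasDerivAt (fun x => p x • h x) (p' • h 0) 0 := by
  rw [hasDerivAt_iff_tendsto_slope] at hp ⊢
  refine (hp.smul (hh.tendsto.mono_left nhdsWithin_le_nhds)).congr fun x => ?_
  simp [slope, h0, smul_smul]

theorem continuousAt_coeffDeriv {g : (Fin n → 𝕜) → Matrix (Fin n) (Fin n) 𝕜}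
    {u η : ℝ → Fin n → 𝕜} {x : ℝ} (hg : ∀ i j, ContDiffAt 𝕜 ∞ (fun w => g w i j) (u x))
    (hu : ContinuousAt u x) (hη : ContinuousAt η x) :
    ContinuousAt (fun y => coeffDeriv g (u y) (η y)) x := by
  refine continuousAt_pi.2 fun i => continuousAt_pi.2 fun j => ?_
  have h1 : ContinuousAt (fderiv 𝕜 fun w => g w i j) (u x) :=
    ((hg i j).fderiv_right (m := 0) (by simp)).continuousAt
  exact (ContinuousAt.comp (f := u) h1 hu).clm_apply hη

theorem contDiffAt_velocityMatrix {V : (Fin n → 𝕜) → Fin n → 𝕜} {v : Fin n → 𝕜}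
    (hV : ContDiffAt 𝕜 ∞ V v) (i j : Fin n) :
    ContDiffAt 𝕜 ∞ (fun w => velocityMatrix V w i j) v := by
  have h1 : ContDiffAt 𝕜 ∞ (fderiv 𝕜 V) v := hV.fderiv_right (by simp)
  have h2 := h1.clm_apply (contDiffAt_const (c := (Pi.single j 1 : Fin n → 𝕜)))
  exact contDiffAt_pi.1 h2 i

theorem velocityMatrix_mulVec (V : (Fin n → 𝕜) → Fin n → 𝕜) (v ξ : Fin n → 𝕜) :
    velocityMatrix V v *ᵥ ξ = fderiv 𝕜 V v ξ := by
  conv_rhs => rw [pi_eq_sum_univ' ξ]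
  ext i
  simp [velocityMatrix, Matrix.mulVec, dotProduct, Finset.sum_apply, mul_comm, map_sum]

variable {g : (Fin n → 𝕜) → Matrix (Fin n) (Fin n) 𝕜} {V : (Fin n → 𝕜) → Fin n → 𝕜}
  {Ω : Set (Fin n → 𝕜)}

/-- The compatibility condition along the straight line `x ↦ v + x ξ` and for the covector
`ψ = q e`, where `q` is a scalar function with derivatives `p` and `p'`. -/
theorem IsCompatible.deriv_line (hΩ : IsOpen Ω) (hg : ∀ i j, ContDiffOn 𝕜 ∞ (fun u => g u i j) Ω)
    (hV : ContDiffOn 𝕜 ∞ V Ω) (hc : IsCompatible g V Ω) {v : Fin n → 𝕜} (hv : v ∈ Ω)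
    (ξ e : Fin n → 𝕜) {q p p' : ℝ → ℝ} (hq : ContDiff ℝ ∞ q) (hqp : ∀ x, HasDerivAt q (p x) x)
    (hpp : ∀ x, HasDerivAt p (p' x) x) {u : ℝ → Fin n → 𝕜} (hu : u = fun x => v + x • ξ) :
    deriv (fun x => p x • (coeffDeriv g (u x) (velocityMatrix V (u x) *ᵥ ξ) *ᵥ e)) 0 =
      deriv (fun x => p' x • (velocityMatrix V (u x) *ᵥ (g (u x) *ᵥ e)) +
        p x • (velocityMatrix V (u x) *ᵥ (coeffDeriv g (u x) ξ *ᵥ e))) 0 -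
      deriv (fun x => p' x • (g (u x) *ᵥ ((velocityMatrix V (u x))ᵀ *ᵥ e)) +
        p x • (g (u x) *ᵥ ((coeffDeriv (velocityMatrix V) (u x) ξ)ᵀ *ᵥ e))) 0 := by
  have hus : ContDiff ℝ ∞ u := by
    rw [hu]
    exact contDiff_const.add (contDiff_id.smul contDiff_const)
  have hud : ∀ x, HasDerivAt u ξ x := by
    intro x
    rw [hu]
    simpa using ((hasDerivAt_id x).smul_const ξ).const_add v
  have hu0 : u 0 ∈ Ω := by simpa [hu] using hv
  have hev : ∀ᶠ x in nhds (0 : ℝ), u x ∈ Ω :=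
    hus.continuous.continuousAt.eventually (hΩ.mem_nhds hu0)
  have hdψ : deriv (fun x => q x • e) = fun x => p x • e := by
    ext1 x
    exact ((hqp x).smul_const e).deriv
  have hpe : ∀ x, HasDerivAt (fun x => p x • e) (p' x • e) x := fun x => (hpp x).smul_const e
  have hgd : ∀ x, u x ∈ Ω → ∀ i j, DifferentiableAt 𝕜 (fun w => g w i j) (u x) :=
    fun x hx i j => ((hg i j).contDiffAt (hΩ.mem_nhds hx)).differentiableAt (by simp)
  have hWd : ∀ x, u x ∈ Ω → ∀ i j, DifferentiableAt 𝕜 (fun w => velocityMatrix V w i j) (u x) :=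
    fun x hx i j => (contDiffAt_velocityMatrix (hV.contDiffAt (hΩ.mem_nhds hx)) i j).differentiableAt
      (by simp)
  have h := hc u (fun x => q x • e) hus (hq.smul contDiff_const) 0 hu0
  have e1 : (fun x => coeffDeriv g (u x) (flow V u x) *ᵥ deriv (fun x => q x • e) x) =ᶠ[nhds 0]
      fun x => p x • (coeffDeriv g (u x) (velocityMatrix V (u x) *ᵥ ξ) *ᵥ e) := by
    filter_upwards [hev] with x hx
    have hf : flow V u x = velocityMatrix V (u x) *ᵥ ξ := by
      rw [velocityMatrix_mulVec]
      exact ((((hV.contDiffAt (hΩ.mem_nhds hx)).differentiableAt (by simp)).hasFDerivAt.restrictScalars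
        ℝ).comp_hasDerivAt x (hud x)).deriv
    rw [hf, hdψ, Matrix.mulVec_smul]
  have e2 : (fun x => velocityMatrix V (u x) *ᵥ op g u (fun x => q x • e) x) =ᶠ[nhds 0]
      fun x => p' x • (velocityMatrix V (u x) *ᵥ (g (u x) *ᵥ e)) +
        p x • (velocityMatrix V (u x) *ᵥ (coeffDeriv g (u x) ξ *ᵥ e)) := by
    filter_upwards [hev] with x hx
    have := (hasDerivAt_mulVec (M := fun y => g (u y))
      (hasDerivAt_matrix_comp (hgd x hx) (hud x)) (hpe x)).deriv
    unfold op
    rw [hdψ, this]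
    simp only [Matrix.mulVec_add, Matrix.mulVec_smul]
    abel
  have e3 : (fun x => g (u x) *ᵥ deriv (linearizationAdjoint V u (fun x => q x • e)) x) =ᶠ[nhds 0]
      -fun x => p' x • (g (u x) *ᵥ ((velocityMatrix V (u x))ᵀ *ᵥ e)) +
        p x • (g (u x) *ᵥ ((coeffDeriv (velocityMatrix V) (u x) ξ)ᵀ *ᵥ e)) := by
    filter_upwards [hev] with x hx
    have := (hasDerivAt_mulVec (M := fun y => (velocityMatrix V (u y))ᵀ)
      (M' := (coeffDeriv (velocityMatrix V) (u x) ξ)ᵀ)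
      (fun i j => hasDerivAt_matrix_comp (hWd x hx) (hud x) j i) (hpe x)).neg.deriv
    unfold linearizationAdjoint
    rw [hdψ]
    refine (congrArg (g (u x) *ᵥ ·) this).trans ?_
    simp only [Matrix.mulVec_add, Matrix.mulVec_smul, Matrix.mulVec_neg, Pi.neg_apply]
    abel
  unfold opDeriv linearization at h
  rw [e1.deriv_eq, e2.deriv_eq] at h
  unfold op at h
  rw [e3.deriv_eq, deriv.neg] at h
  rw [h, sub_eq_add_neg]

theorem mulVec_ext {A B : Matrix (Fin n) (Fin n) 𝕜} (h : ∀ e, A *ᵥ e = B *ᵥ e) : A = B :=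
  Matrix.mulVec_injective (funext h)

/-- This is the coefficient of ψ''' in the compatibility condition. -/
theorem IsCompatible.velocityMatrix_mul (hΩ : IsOpen Ω)
    (hg : ∀ i j, ContDiffOn 𝕜 ∞ (fun u => g u i j) Ω)
    (hV : ContDiffOn 𝕜 ∞ V Ω) (hc : IsCompatible g V Ω) {v : Fin n → 𝕜} (hv : v ∈ Ω) :
    velocityMatrix V v * g v = g v * (velocityMatrix V v)ᵀ := by
  refine mulVec_ext fun e => ?_
  -- A constant field and ψ = (x³/6) e, whose only nonzero derivative at 0 is the third.
  have h := hc.deriv_line hΩ hg hV hv 0 e (q := fun x => x ^ 3 / 6) (p := fun x => x ^ 2 / 2)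
    (p' := fun x => x) (by fun_prop)
    (fun x => ((hasDerivAt_pow 3 x).div_const 6).congr_deriv (by norm_num; ring))
    (fun x => ((hasDerivAt_pow 2 x).div_const 2).congr_deriv (by norm_num)) rfl
  have hp : HasDerivAt (fun x : ℝ => x ^ 2 / 2) 0 0 :=
    ((hasDerivAt_pow 2 (0 : ℝ)).div_const 2).congr_deriv (by norm_num)
  have hs : ∀ a b : Fin n → 𝕜, deriv (fun x : ℝ => x • a + (x ^ 2 / 2) • b) 0 = a := by
    intro a b
    have := (hasDerivAt_zero_smul (hasDerivAt_id (0 : ℝ)) rfl (continuousAt_const (y := a))).fun_add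
      (hasDerivAt_zero_smul hp (by simp) (continuousAt_const (y := b)))
    simpa using this.deriv
  simp only [smul_zero, add_zero, hs] at h
  have hz : ∀ a : Fin n → 𝕜, deriv (fun x : ℝ => (x ^ 2 / 2) • a) 0 = 0 := by
    intro a
    simpa using (hp.smul_const a).deriv
  rw [hz] at h
  simpa using (sub_eq_zero.1 h.symm)

/-- This is the coefficient of ψ'', tested with ψ = (x²/2) e along a line with velocity ξ. -/
theorem IsCompatible.coeffDeriv_velocityMatrix_mulVec (hΩ : IsOpen Ω)
    (hg : ∀ i j, ContDiffOn 𝕜 ∞ (fun u => g u i j) Ω)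
    (hV : ContDiffOn 𝕜 ∞ V Ω) (hc : IsCompatible g V Ω) {v : Fin n → 𝕜} (hv : v ∈ Ω)
    (ξ : Fin n → 𝕜) :
    coeffDeriv g v (velocityMatrix V v *ᵥ ξ) =
      velocityMatrix V v * coeffDeriv g v ξ -
        g v * (coeffDeriv (velocityMatrix V) v ξ)ᵀ := by
  have hgv : ∀ i j, ContDiffAt 𝕜 ∞ (fun u => g u i j) v :=
    fun i j => (hg i j).contDiffAt (hΩ.mem_nhds hv)
  have hWv : ∀ i j, ContDiffAt 𝕜 ∞ (fun u => velocityMatrix V u i j) v :=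
    contDiffAt_velocityMatrix (hV.contDiffAt (hΩ.mem_nhds hv))
  refine mulVec_ext fun e => ?_
  obtain ⟨u, hu⟩ : ∃ u : ℝ → Fin n → 𝕜, u = fun x => v + x • ξ := ⟨_, rfl⟩
  have hu0 : u 0 = v := by simp [hu]
  have hud : HasDerivAt u ξ 0 := by
    rw [hu]
    simpa using ((hasDerivAt_id (0 : ℝ)).smul_const ξ).const_add v
  have huc := hud.continuousAt
  have hev : ∀ᶠ x in nhds (0 : ℝ), u x ∈ Ω :=
    huc.eventually (hΩ.mem_nhds (hu0.symm ▸ hv))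
  have h := hc.deriv_line hΩ hg hV hv ξ e (q := fun x => x ^ 2 / 2) (p := fun x => x)
    (p' := fun _ => 1) (by fun_prop)
    (fun x => ((hasDerivAt_pow 2 x).div_const 2).congr_deriv (by norm_num)) hasDerivAt_id hu
  rw [← hu0] at hgv hWv
  have hgd : ∀ i j, HasDerivAt (fun y => g (u y) i j) (coeffDeriv g (u 0) ξ i j) 0 :=
    hasDerivAt_matrix_comp (fun i j => (hgv i j).differentiableAt (by simp)) hud
  have hWd : ∀ i j, HasDerivAt (fun y => velocityMatrix V (u y) i j)
      (coeffDeriv (velocityMatrix V) (u 0) ξ i j) 0 :=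
    hasDerivAt_matrix_comp (fun i j => (hWv i j).differentiableAt (by simp)) hud
  have hgc : ContinuousAt (fun y => g (u y)) 0 :=
    continuousAt_pi.2 fun i => continuousAt_pi.2 fun j => (hgd i j).continuousAt
  have hWc : ContinuousAt (fun y => velocityMatrix V (u y)) 0 :=
    continuousAt_pi.2 fun i => continuousAt_pi.2 fun j => (hWd i j).continuousAt
  have hmv : ∀ {M : ℝ → Matrix (Fin n) (Fin n) 𝕜} {a : ℝ → Fin n → 𝕜}, ContinuousAt M 0 →
      ContinuousAt a 0 → ContinuousAt (fun x => M x *ᵥ a x) 0 := by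
    intro M a hM ha
    exact (Continuous.matrix_mulVec continuous_fst continuous_snd).continuousAt.comp (hM.prodMk ha)
  have c1 := hmv (continuousAt_coeffDeriv hgv huc (hmv hWc (continuousAt_const (y := ξ))))
    (continuousAt_const (y := e))
  have c2 := hmv hWc (hmv (continuousAt_coeffDeriv hgv huc (continuousAt_const (y := ξ)))
    (continuousAt_const (y := e)))
  have hWt : ContinuousAt (fun x => (coeffDeriv (velocityMatrix V) (u x) ξ)ᵀ) 0 :=
    (Continuous.matrix_transpose continuous_id).continuousAt.comp
      (continuousAt_coeffDeriv hWv huc (continuousAt_const (y := ξ)))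
  have c3 := hmv hgc (hmv hWt (continuousAt_const (y := e)))
  have d := hasDerivAt_mulVec hWd (hasDerivAt_mulVec hgd (hasDerivAt_const (0 : ℝ) e))
  -- Wg = gWᵀ holds along the line near 0, so the leading terms on the two sides have the same
  -- derivative and cancel.
  have d' := d.congr_of_eventuallyEq
    (f₁ := fun y => g (u y) *ᵥ ((velocityMatrix V (u y))ᵀ *ᵥ e)) (by
      filter_upwards [hev] with x hx
      rw [Matrix.mulVec_mulVec, Matrix.mulVec_mulVec, hc.velocityMatrix_mul hΩ hg hV hx])
  simp only [one_smul] at h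
  have hid : HasDerivAt (fun x : ℝ => x) 1 0 := hasDerivAt_id 0
  rw [(hasDerivAt_zero_smul hid rfl c1).deriv,
    (d.fun_add (hasDerivAt_zero_smul hid rfl c2)).deriv,
    (d'.fun_add (hasDerivAt_zero_smul hid rfl c3)).deriv, hu0] at h
  simp only [one_smul] at h
  rw [h, add_sub_add_left_eq_sub, Matrix.sub_mulVec, Matrix.mulVec_mulVec, Matrix.mulVec_mulVec]

end Compatibility

/-! ### The inverse matrix g⁻¹ and its constant skew derivatives -/

section LocalStructure

variable {𝕜 : Type*} [RCLike 𝕜] {n : ℕ}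

theorem contDiffOn_det {g : (Fin n → 𝕜) → Matrix (Fin n) (Fin n) 𝕜} {Ω : Set (Fin n → 𝕜)}
    (hg : ∀ i j, ContDiffOn 𝕜 ∞ (fun u => g u i j) Ω) :
    ContDiffOn 𝕜 ∞ (fun u => (g u).det) Ω := by
  simp only [Matrix.det_apply]
  refine ContDiffOn.sum fun σ _ => ContDiffOn.const_smul _ ?_
  exact contDiffOn_prod fun i _ => hg _ _

theorem contDiffOn_inv {g : (Fin n → 𝕜) → Matrix (Fin n) (Fin n) 𝕜} {Ω : Set (Fin n → 𝕜)}
    (hg : ∀ i j, ContDiffOn 𝕜 ∞ (fun u => g u i j) Ω) (hd : ∀ u ∈ Ω, (g u).det ≠ 0)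
    (i j : Fin n) : ContDiffOn 𝕜 ∞ (fun u => (g u)⁻¹ i j) Ω := by
  simp only [Matrix.inv_def, Ring.inverse_eq_inv', Matrix.smul_apply, smul_eq_mul,
    Matrix.adjugate_apply]
  refine ((contDiffOn_det hg).inv hd).mul (contDiffOn_det fun r c => ?_)
  by_cases h : r = j
  · subst h
    simp only [Matrix.updateRow_self]
    exact contDiffOn_const
  · simp only [Matrix.updateRow_ne h]
    exact hg r c

theorem coeffDeriv_mul {A B : (Fin n → 𝕜) → Matrix (Fin n) (Fin n) 𝕜} {v : Fin n → 𝕜}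
    (hA : ∀ i j, DifferentiableAt 𝕜 (fun u => A u i j) v)
    (hB : ∀ i j, DifferentiableAt 𝕜 (fun u => B u i j) v) (ξ : Fin n → 𝕜) :
    coeffDeriv (fun u => A u * B u) v ξ = coeffDeriv A v ξ * B v + A v * coeffDeriv B v ξ := by
  ext i j
  have h := HasFDerivAt.fun_sum (u := Finset.univ) fun k _ =>
    (hA i k).hasFDerivAt.mul (hB k j).hasFDerivAt
  simp only [coeffDeriv, Matrix.mul_apply, Matrix.of_apply, Matrix.add_apply]
  refine (congrArg (· ξ) h.fderiv).trans ?_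
  simp [Finset.sum_add_distrib, mul_comm, add_comm]

theorem coeffDeriv_congr {A B : (Fin n → 𝕜) → Matrix (Fin n) (Fin n) 𝕜} {v : Fin n → 𝕜}
    (h : A =ᶠ[nhds v] B) (ξ : Fin n → 𝕜) : coeffDeriv A v ξ = coeffDeriv B v ξ := by
  ext i j
  simp only [coeffDeriv, Matrix.of_apply]
  rw [Filter.EventuallyEq.fderiv_eq (f := fun w => B w i j)]
  filter_upwards [h] with w hw
  rw [hw]

theorem coeffDeriv_const (C : Matrix (Fin n) (Fin n) 𝕜) (v ξ : Fin n → 𝕜) :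
    coeffDeriv (fun _ => C) v ξ = 0 := by
  ext i j
  simp [coeffDeriv]

theorem coeffDeriv_transpose (A : (Fin n → 𝕜) → Matrix (Fin n) (Fin n) 𝕜) (v ξ : Fin n → 𝕜) :
    coeffDeriv (fun u => (A u)ᵀ) v ξ = (coeffDeriv A v ξ)ᵀ := rfl

theorem coeffDeriv_neg (A : (Fin n → 𝕜) → Matrix (Fin n) (Fin n) 𝕜) (v ξ : Fin n → 𝕜) :
    coeffDeriv (fun u => -A u) v ξ = -coeffDeriv A v ξ := by
  ext i j
  simp only [coeffDeriv, Matrix.neg_apply, Matrix.of_apply]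
  rw [fderiv_fun_neg]
  rfl

theorem coeffDeriv_eq_sum (A : (Fin n → 𝕜) → Matrix (Fin n) (Fin n) 𝕜) (v ξ : Fin n → 𝕜) :
    coeffDeriv A v ξ = ∑ k, ξ k • coeffDeriv A v (Pi.single k 1) := by
  ext i j
  conv_lhs => rw [pi_eq_sum_univ' ξ]
  simp [coeffDeriv, Matrix.sum_apply, map_sum]

theorem clm_eq_sum {F : Type*} [NormedAddCommGroup F] [NormedSpace 𝕜 F]
    (L : (Fin n → 𝕜) →L[𝕜] F) (ξ : Fin n → 𝕜) :
    L ξ = ∑ k, ξ k • L (Pi.single k 1) := by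
  conv_lhs => rw [pi_eq_sum_univ' ξ]
  simp [map_sum]

/-- A function with constant partial derivatives on a ball is affine there. -/
theorem eq_add_sum_of_fderiv_eq {F : (Fin n → 𝕜) → 𝕜} {v : Fin n → 𝕜} {ε : ℝ} {c : Fin n → 𝕜}
    (hF : ∀ u ∈ Metric.ball v ε, DifferentiableAt 𝕜 F u)
    (hc : ∀ u ∈ Metric.ball v ε, ∀ l, fderiv 𝕜 F u (Pi.single l 1) = c l)
    {u : Fin n → 𝕜} (hu : u ∈ Metric.ball v ε) :
    F u = F v + ∑ l, c l * (u l - v l) := by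
  let L : (Fin n → 𝕜) →L[𝕜] 𝕜 := ∑ l, c l • ContinuousLinearMap.proj l
  have hL : ∀ w, L w = ∑ l, c l * w l := fun w => by simp [L]
  have hv : v ∈ Metric.ball v ε := Metric.mem_ball_self (Metric.pos_of_mem_ball hu)
  have h := Metric.isOpen_ball.is_const_of_fderiv_eq_zero (𝕜 := 𝕜) (f := fun w => F w - L w)
    (convex_ball v ε).isPreconnected
    (fun w hw => ((hF w hw).sub L.differentiableAt).differentiableWithinAt)
    (fun w hw => by
      rw [((hF w hw).hasFDerivAt.fun_sub L.hasFDerivAt).fderiv]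
      ext ξ
      rw [clm_eq_sum]
      simp [hc w hw, hL, Pi.single_apply]) hu hv
  have h2 : ∑ l, c l * (u l - v l) = L u - L v := by
    rw [hL, hL, ← Finset.sum_sub_distrib]
    simp only [mul_sub]
  rw [h2]
  linear_combination h

variable {g : (Fin n → 𝕜) → Matrix (Fin n) (Fin n) 𝕜} {V : (Fin n → 𝕜) → Fin n → 𝕜}
  {Ω : Set (Fin n → 𝕜)}

theorem IsSecondOrderHHO.isUnit_det (hg : IsSecondOrderHHO g Ω) {v : Fin n → 𝕜} (hv : v ∈ Ω) :
    IsUnit (g v).det := isUnit_iff_ne_zero.2 (hg.nondegenerate v hv)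

theorem IsSecondOrderHHO.contDiffAt (hΩ : IsOpen Ω) (hg : IsSecondOrderHHO g Ω) {v : Fin n → 𝕜}
    (hv : v ∈ Ω) (i j : Fin n) : ContDiffAt 𝕜 ∞ (fun u => g u i j) v :=
  (hg.smooth i j).contDiffAt (hΩ.mem_nhds hv)

theorem IsSecondOrderHHO.contDiffAt_inv (hΩ : IsOpen Ω) (hg : IsSecondOrderHHO g Ω)
    {v : Fin n → 𝕜} (hv : v ∈ Ω) (i j : Fin n) : ContDiffAt 𝕜 ∞ (fun u => (g u)⁻¹ i j) v :=
  (contDiffOn_inv hg.smooth hg.nondegenerate i j).contDiffAt (hΩ.mem_nhds hv)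

theorem IsSecondOrderHHO.differentiableAt_inv (hΩ : IsOpen Ω) (hg : IsSecondOrderHHO g Ω)
    {v : Fin n → 𝕜} (hv : v ∈ Ω) (i j : Fin n) : DifferentiableAt 𝕜 (fun u => (g u)⁻¹ i j) v :=
  (hg.contDiffAt_inv hΩ hv i j).differentiableAt (by simp)

theorem IsSecondOrderHHO.coeffDeriv_mul_inv (hΩ : IsOpen Ω) (hg : IsSecondOrderHHO g Ω)
    {v : Fin n → 𝕜} (hv : v ∈ Ω) (ξ : Fin n → 𝕜) :
    coeffDeriv g v ξ * (g v)⁻¹ = -(g v * coeffDeriv (fun u => (g u)⁻¹) v ξ) := by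
  have h := coeffDeriv_mul (fun i j => (hg.contDiffAt hΩ hv i j).differentiableAt (by simp))
    (hg.differentiableAt_inv hΩ hv) ξ
  have h1 : (fun u => g u * (g u)⁻¹) =ᶠ[nhds v] fun _ => 1 := by
    filter_upwards [hΩ.mem_nhds hv] with u hu
    exact Matrix.mul_nonsing_inv _ (hg.isUnit_det hu)
  rw [coeffDeriv_congr h1, coeffDeriv_const] at h
  exact eq_neg_of_add_eq_zero_left h.symm

theorem IsSecondOrderHHO.coeffDeriv_inv (hΩ : IsOpen Ω) (hg : IsSecondOrderHHO g Ω)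
    {v : Fin n → 𝕜} (hv : v ∈ Ω) (ξ : Fin n → 𝕜) :
    coeffDeriv (fun u => (g u)⁻¹) v ξ = -((g v)⁻¹ * coeffDeriv g v ξ * (g v)⁻¹) := by
  rw [Matrix.mul_assoc, hg.coeffDeriv_mul_inv hΩ hv, Matrix.mul_neg, neg_neg, ← Matrix.mul_assoc,
    Matrix.nonsing_inv_mul _ (hg.isUnit_det hv), Matrix.one_mul]

theorem IsSecondOrderHHO.transpose_inv (hg : IsSecondOrderHHO g Ω) {v : Fin n → 𝕜}
    (hv : v ∈ Ω) : ((g v)⁻¹)ᵀ = -(g v)⁻¹ := by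
  rw [Matrix.transpose_nonsing_inv, hg.transpose_eq_neg hv]
  apply Matrix.inv_eq_right_inv
  rw [neg_mul_neg, Matrix.mul_nonsing_inv _ (hg.isUnit_det hv)]

/-- The partial derivatives `Tᵢⱼₖ = ∂gᵢⱼ/∂uᵏ` of the inverse matrix `(gᵢⱼ) = (gⁱʲ)⁻¹`. -/
noncomputable def torsion (g : (Fin n → 𝕜) → Matrix (Fin n) (Fin n) 𝕜) (i j k : Fin n)
    (v : Fin n → 𝕜) : 𝕜 :=
  coeffDeriv (fun u => (g u)⁻¹) v (Pi.single k 1) i j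

theorem IsSecondOrderHHO.torsion_swap (hΩ : IsOpen Ω) (hg : IsSecondOrderHHO g Ω)
    {v : Fin n → 𝕜} (hv : v ∈ Ω) (i j k : Fin n) : torsion g i j k v = -torsion g j i k v := by
  have h1 : (fun u => ((g u)⁻¹)ᵀ) =ᶠ[nhds v] fun u => -(g u)⁻¹ := by
    filter_upwards [hΩ.mem_nhds hv] with u hu
    exact hg.transpose_inv hu
  have h := coeffDeriv_congr h1 (Pi.single k 1)
  rw [coeffDeriv_neg, coeffDeriv_transpose] at h
  have := congrFun (congrFun h j) i
  simpa [torsion] using this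

/-- T is the tensor of `coeffDeriv_cyclic` with all three indices lowered by g⁻¹ (`key`), which
preserves cyclic symmetry. -/
theorem IsSecondOrderHHO.torsion_cyclic (hΩ : IsOpen Ω) (hg : IsSecondOrderHHO g Ω)
    {v : Fin n → 𝕜} (hv : v ∈ Ω) (i j k : Fin n) : torsion g i j k v = torsion g j k i v := by
  have hr : ∀ F : Fin n → Fin n → Fin n → 𝕜, ∑ a, ∑ b, ∑ c, F a b c = ∑ b, ∑ c, ∑ a, F a b c := by
    intro F
    rw [Finset.sum_comm]
    exact Finset.sum_congr rfl fun b _ => Finset.sum_comm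
  have key : ∀ i j k, torsion g i j k v = ∑ a, ∑ b, ∑ c, (g v)⁻¹ a i * (g v)⁻¹ b j *
      (g v)⁻¹ c k * coeffDeriv g v (g v *ᵥ Pi.single c 1) a b := by
    intro i j k
    have h1 : coeffDeriv g v (Pi.single k 1) =
        ∑ c, (g v)⁻¹ c k • coeffDeriv g v (g v *ᵥ Pi.single c 1) := by
      have : (Pi.single k 1 : Fin n → 𝕜) = ∑ c, (g v)⁻¹ c k • (g v *ᵥ Pi.single c 1) := by
        simp_rw [← Matrix.mulVec_smul]
        rw [← Matrix.mulVec_sum]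
        have h2 : ∑ c, (g v)⁻¹ c k • (Pi.single c 1 : Fin n → 𝕜) = (g v)⁻¹ *ᵥ Pi.single k 1 := by
          rw [pi_eq_sum_univ' ((g v)⁻¹ *ᵥ Pi.single k 1)]
          simp
        rw [h2, Matrix.mulVec_mulVec, Matrix.mul_nonsing_inv _ (hg.isUnit_det hv),
          Matrix.one_mulVec]
      conv_lhs => rw [this]
      ext a b
      simp [coeffDeriv, Matrix.sum_apply, map_sum]
    have h3 : ∀ a, (g v)⁻¹ i a = -(g v)⁻¹ a i := fun a => by
      have := congrFun (congrFun (hg.transpose_inv hv) a) i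
      simpa using this
    rw [torsion, hg.coeffDeriv_inv hΩ hv, h1]
    simp only [Matrix.neg_apply, Matrix.mul_apply, Finset.sum_mul, h3, Matrix.sum_apply,
      Matrix.smul_apply, smul_eq_mul, Finset.mul_sum, ← Finset.sum_neg_distrib]
    rw [Finset.sum_comm, hr (fun a b c => (g v)⁻¹ a i * (g v)⁻¹ b j * (g v)⁻¹ c k *
      coeffDeriv g v (g v *ᵥ Pi.single c 1) a b)]
    refine Finset.sum_congr rfl fun a _ => Finset.sum_congr rfl fun b _ =>
      Finset.sum_congr rfl fun c _ => ?_
    ring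
  rw [key, key]
  rw [hr]
  refine Finset.sum_congr rfl fun a _ => Finset.sum_congr rfl fun b _ =>
    Finset.sum_congr rfl fun c _ => ?_
  rw [hg.coeffDeriv_cyclic hv c a b]
  ring

theorem IsSecondOrderHHO.contDiffAt_torsion (hΩ : IsOpen Ω) (hg : IsSecondOrderHHO g Ω)
    {v : Fin n → 𝕜} (hv : v ∈ Ω) (i j k : Fin n) : ContDiffAt 𝕜 ∞ (torsion g i j k) v :=
  ((hg.contDiffAt_inv hΩ hv i j).fderiv_right (by simp)).clm_apply contDiffAt_const

theorem IsSecondOrderHHO.fderiv_torsion (hΩ : IsOpen Ω) (hg : IsSecondOrderHHO g Ω)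
    {v : Fin n → 𝕜} (hv : v ∈ Ω) (i j k : Fin n) : fderiv 𝕜 (torsion g i j k) v = 0 := by
  let X : Fin n → Fin n → Fin n → Fin n → 𝕜 :=
    fun i j k l => fderiv 𝕜 (torsion g i j k) v (Pi.single l 1)
  have hsymm : ∀ i j k l, X i j k l = X i j l k := by
    intro i j k l
    have hs := (hg.contDiffAt_inv hΩ hv i j).isSymmSndFDerivAt (by
      rw [minSmoothness_of_isRCLikeNormedField]
      exact WithTop.coe_le_coe.2 (le_top : (2 : ℕ∞) ≤ ⊤))
    have hX : ∀ k l, X i j k l =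
        fderiv 𝕜 (fderiv 𝕜 fun u => (g u)⁻¹ i j) v (Pi.single l 1) (Pi.single k 1) := by
      intro k l
      have hd : DifferentiableAt 𝕜 (fderiv 𝕜 fun u => (g u)⁻¹ i j) v :=
        ((hg.contDiffAt_inv hΩ hv i j).fderiv_right (m := ∞) (by simp)).differentiableAt (by simp)
      refine (congrArg (· (Pi.single l 1))
        (hd.hasFDerivAt.clm_apply (hasFDerivAt_const (Pi.single k 1 : Fin n → 𝕜) v)).fderiv).trans ?_
      simp
    rw [hX, hX]
    exact hs _ _
  have hcyc : ∀ i j k l, X i j k l = X j k i l := by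
    intro i j k l
    have : torsion g i j k =ᶠ[nhds v] torsion g j k i := by
      filter_upwards [hΩ.mem_nhds hv] with u hu
      exact hg.torsion_cyclic hΩ hu i j k
    simp only [X, this.fderiv_eq]
  have hskew : ∀ i j k l, X i j k l = -X j i k l := by
    intro i j k l
    have : torsion g i j k =ᶠ[nhds v] fun u => -torsion g j i k u := by
      filter_upwards [hΩ.mem_nhds hv] with u hu
      exact hg.torsion_swap hΩ hu i j k
    simp only [X, this.fderiv_eq]
    rw [fderiv_fun_neg]
    rfl
  ext ξ
  rw [clm_eq_sum]
  refine Finset.sum_eq_zero fun l _ => ?_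
  have h0 : X i j k l = 0 := by
    have hskew' : ∀ i j k l, X i j k l = -X i k j l := by
      intro i j k l
      rw [hcyc i j k l, hskew j k i l, hcyc k j i l, hcyc j i k l]
    -- X is skew in its second and third indices and symmetric in its third and fourth. Alternating
    -- the two swaps three times is the identity permutation, but contributes the sign (-1)³.
    have h : X i j k l = -X i j k l := by
      conv_lhs => rw [hsymm, hskew', hsymm, hskew', hsymm, hskew']
      ring
    exact self_eq_neg.1 h
  simp only [X] at h0
  rw [h0, smul_zero]

end LocalStructure

/-! ### Compatible fluxes: affinity of g⁻¹V -/

section AffineStructure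

variable {𝕜 : Type*} [RCLike 𝕜] {n : ℕ}
  {g : (Fin n → 𝕜) → Matrix (Fin n) (Fin n) 𝕜} {V : (Fin n → 𝕜) → Fin n → 𝕜}
  {Ω : Set (Fin n → 𝕜)}

theorem IsCompatible.inv_mul_velocityMatrix (hΩ : IsOpen Ω) (hg : IsSecondOrderHHO g Ω)
    (hV : ContDiffOn 𝕜 ∞ V Ω) (hc : IsCompatible g V Ω) {v : Fin n → 𝕜} (hv : v ∈ Ω) :
    (g v)⁻¹ * velocityMatrix V v = (velocityMatrix V v)ᵀ * (g v)⁻¹ := by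
  have h := hc.velocityMatrix_mul hΩ hg.smooth hV hv
  have hd := hg.isUnit_det hv
  calc (g v)⁻¹ * velocityMatrix V v
      = (g v)⁻¹ * (velocityMatrix V v * g v) * (g v)⁻¹ := by
        rw [Matrix.mul_assoc, Matrix.mul_assoc, Matrix.mul_nonsing_inv _ hd, Matrix.mul_one]
    _ = _ := by
        rw [h, ← Matrix.mul_assoc, Matrix.nonsing_inv_mul _ hd, Matrix.one_mul]

/-- Differentiate the equal product Wᵀg⁻¹ instead: its two terms are those obtained by conjugating
the first-order compatibility relation with g⁻¹. -/
theorem IsCompatible.coeffDeriv_inv_mul_velocityMatrix (hΩ : IsOpen Ω)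
    (hg : IsSecondOrderHHO g Ω) (hV : ContDiffOn 𝕜 ∞ V Ω) (hc : IsCompatible g V Ω)
    {v : Fin n → 𝕜} (hv : v ∈ Ω) (ξ : Fin n → 𝕜) :
    coeffDeriv (fun u => (g u)⁻¹ * velocityMatrix V u) v ξ =
      coeffDeriv (fun u => (g u)⁻¹) v (velocityMatrix V v *ᵥ ξ) := by
  have hWd : ∀ i j, DifferentiableAt 𝕜 (fun u => velocityMatrix V u i j) v := fun i j =>
    (contDiffAt_velocityMatrix (hV.contDiffAt (hΩ.mem_nhds hv)) i j).differentiableAt (by simp)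
  have h1 : (fun u => (g u)⁻¹ * velocityMatrix V u) =ᶠ[nhds v]
      fun u => (velocityMatrix V u)ᵀ * (g u)⁻¹ := by
    filter_upwards [hΩ.mem_nhds hv] with u hu
    exact hc.inv_mul_velocityMatrix hΩ hg hV hu
  have hd := hg.isUnit_det hv
  rw [coeffDeriv_congr h1, coeffDeriv_mul (A := fun u => (velocityMatrix V u)ᵀ) (fun i j => hWd j i) (hg.differentiableAt_inv hΩ hv),
    coeffDeriv_transpose, hg.coeffDeriv_inv hΩ hv (velocityMatrix V v *ᵥ ξ),
    hc.coeffDeriv_velocityMatrix_mulVec hΩ hg.smooth hV hv, Matrix.mul_sub, Matrix.sub_mul,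
    ← Matrix.mul_assoc (g v)⁻¹ (g v), Matrix.nonsing_inv_mul _ hd, Matrix.one_mul,
    ← Matrix.mul_assoc, hc.inv_mul_velocityMatrix hΩ hg hV hv, Matrix.mul_assoc,
    Matrix.mul_assoc, hg.coeffDeriv_mul_inv hΩ hv, Matrix.mul_neg,
    ← Matrix.mul_assoc (g v)⁻¹ (g v), Matrix.nonsing_inv_mul _ hd, Matrix.one_mul, Matrix.mul_neg]
  abel

/-- Locally `g⁻¹` is affine with totally skew-symmetric linear part and `g⁻¹ V` is affine. -/
theorem IsCompatible.exists_affine (hΩ : IsOpen Ω) (hg : IsSecondOrderHHO g Ω)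
    (hV : ContDiffOn 𝕜 ∞ V Ω) (hc : IsCompatible g V Ω) {v : Fin n → 𝕜} {ε : ℝ}
    (hε : 0 < ε) (hball : Metric.ball v ε ⊆ Ω) :
    ∃ (T : Fin n → Fin n → Fin n → 𝕜) (A : Matrix (Fin n) (Fin n) 𝕜),
      (∀ i j k, T i j k = -T i k j) ∧ ∀ u ∈ Metric.ball v ε,
        (g u)⁻¹ = (g v)⁻¹ + Matrix.of (fun i j => ∑ k, T i j k * (u k - v k)) ∧
        (g u)⁻¹ *ᵥ V u = (g v)⁻¹ *ᵥ V v + A *ᵥ (u - v) ∧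
        (g u)⁻¹ * velocityMatrix V u = A - Matrix.of (fun i k => ∑ j, T i j k * V u j) := by
  have hvb : v ∈ Metric.ball v ε := Metric.mem_ball_self hε
  have hT : ∀ u ∈ Metric.ball v ε, ∀ i j k, torsion g i j k u = torsion g i j k v := by
    intro u hu i j k
    have := eq_add_sum_of_fderiv_eq (F := torsion g i j k) (c := 0)
      (fun w hw => (hg.contDiffAt_torsion hΩ (hball hw) i j k).differentiableAt (by simp))
      (fun w hw l => by rw [hg.fderiv_torsion hΩ (hball hw)]; rfl) hu
    simpa using this
  have hVd : ∀ w ∈ Ω, ∀ j, DifferentiableAt 𝕜 (fun u => V u j) w := fun w hw j =>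
    differentiableAt_pi.1 ((hV.contDiffAt (hΩ.mem_nhds hw)).differentiableAt (by simp)) j
  have hVf : ∀ w ∈ Ω, ∀ j k, fderiv 𝕜 (fun u => V u j) w (Pi.single k 1) =
      velocityMatrix V w j k := by
    intro w hw j k
    have := hasFDerivAt_pi'.1 ((hV.contDiffAt (hΩ.mem_nhds hw)).differentiableAt
      (by simp)).hasFDerivAt j
    rw [this.fderiv]
    rfl
  have hWd : ∀ w ∈ Ω, ∀ i j, DifferentiableAt 𝕜 (fun u => velocityMatrix V u i j) w :=
    fun w hw i j =>
      (contDiffAt_velocityMatrix (hV.contDiffAt (hΩ.mem_nhds hw)) i j).differentiableAt (by simp)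
  have hMd : ∀ w ∈ Ω, ∀ i j, DifferentiableAt 𝕜
      (fun u => ((g u)⁻¹ * velocityMatrix V u) i j) w := by
    intro w hw i j
    simp only [Matrix.mul_apply]
    exact DifferentiableAt.fun_sum fun k _ =>
      (hg.differentiableAt_inv hΩ hw i k).mul (hWd w hw k j)
  have hskew : ∀ u ∈ Ω, ∀ i j k, torsion g i j k u = -torsion g i k j u := by
    intro u hu i j k
    rw [hg.torsion_cyclic hΩ hu i j k, hg.torsion_swap hΩ hu j k i, hg.torsion_cyclic hΩ hu k j i,
      hg.torsion_cyclic hΩ hu j i k]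
  -- F is the gradient of g⁻¹V. It is constant because ∂ₗ(g⁻¹W)ᵢₖ = Tᵢₖⱼ Wʲₗ, and Tᵢₖⱼ = -Tᵢⱼₖ
  -- cancels the derivative of the first sum. Its value is the matrix A.
  let F : Fin n → Fin n → (Fin n → 𝕜) → 𝕜 := fun i k u =>
    (∑ j, torsion g i j k v * V u j) + ((g u)⁻¹ * velocityMatrix V u) i k
  have hF : ∀ u ∈ Metric.ball v ε, ∀ i k, F i k u = F i k v := by
    intro u hu i k
    have hd1 : ∀ w ∈ Ω, HasFDerivAt (fun u => ∑ j, torsion g i j k v * V u j)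
        (∑ j, torsion g i j k v • fderiv 𝕜 (fun u => V u j) w) w := fun w hw =>
      HasFDerivAt.fun_sum fun j _ => (hVd w hw j).hasFDerivAt.const_mul _
    have := eq_add_sum_of_fderiv_eq (F := F i k) (c := 0)
      (fun w hw => ((hd1 w (hball hw)).differentiableAt).add (hMd w (hball hw) i k))
      (fun w hw l => by
        have hM : fderiv 𝕜 (fun u => ((g u)⁻¹ * velocityMatrix V u) i k) w (Pi.single l 1) =
            ∑ j, velocityMatrix V w j l * torsion g i k j v := by
          have h := congrFun (congrFun (hc.coeffDeriv_inv_mul_velocityMatrix hΩ hg hV (hball hw)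
            (Pi.single l 1)) i) k
          rw [coeffDeriv_eq_sum _ _ (velocityMatrix V w *ᵥ _)] at h
          refine h.trans ?_
          simp only [Matrix.sum_apply, Matrix.smul_apply, smul_eq_mul, ← hT w hw]
          simp [torsion]
        refine (congrArg (· (Pi.single l 1)) ((hd1 w (hball hw)).fun_add
          (hMd w (hball hw) i k).hasFDerivAt).fderiv).trans ?_
        rw [add_apply, hM, sum_apply,
          ← Finset.sum_add_distrib]
        refine Finset.sum_eq_zero fun j _ => ?_
        rw [smul_apply, hVf w (hball hw), hskew v (hball hvb) i k j,
          smul_eq_mul]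
        ring) hu
    simpa using this
  refine ⟨fun i j k => torsion g i j k v, Matrix.of fun i k => F i k v,
    hskew v (hball hvb), fun u hu => ⟨?_, ?_, ?_⟩⟩
  · ext i j
    exact eq_add_sum_of_fderiv_eq
      (fun w hw => hg.differentiableAt_inv hΩ (hball hw) i j) (fun w hw k => hT w hw i j k) hu
  · ext i
    simp only [Pi.add_apply]
    have hd : ∀ w ∈ Ω, HasFDerivAt (fun u => ((g u)⁻¹ *ᵥ V u) i) (∑ j,
        ((g w)⁻¹ i j • fderiv 𝕜 (fun u => V u j) w +
          V w j • fderiv 𝕜 (fun u => (g u)⁻¹ i j) w)) w := fun w hw =>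
      HasFDerivAt.fun_sum (u := Finset.univ) fun j _ =>
        (hg.differentiableAt_inv hΩ hw i j).hasFDerivAt.fun_mul (hVd w hw j).hasFDerivAt
    refine eq_add_sum_of_fderiv_eq (fun w hw => (hd w (hball hw)).differentiableAt)
      (fun w hw k => ?_) hu
    rw [(hd w (hball hw)).fderiv, Matrix.of_apply, ← hF w hw]
    simp only [sum_apply, add_apply,
      smul_apply, hVf w (hball hw), smul_eq_mul, F, Matrix.mul_apply,
      ← hT w hw]
    rw [← Finset.sum_add_distrib]
    refine Finset.sum_congr rfl fun j _ => ?_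
    simp only [torsion, coeffDeriv, Matrix.of_apply]
    ring
  · ext i k
    rw [Matrix.sub_apply, Matrix.of_apply, Matrix.of_apply, ← hF u hu]
    simp [F]

end AffineStructure

/-! ### The characteristic determinant as a polynomial -/

section Pencil

variable {R S : Type*} [CommRing R] [CommRing S] {n : ℕ}

/-- The matrix `B + T(w)` depending affinely on `w`. -/
def affineForm (B : Matrix (Fin n) (Fin n) R) (T : Fin n → Fin n → Fin n → R) (w : Fin n → R) :
    Matrix (Fin n) (Fin n) R :=
  B + Matrix.of fun i j => ∑ k, T i j k * w k

/-- A matrix which is polynomial in `w` and, when `y` solves `(B + T(w)) y = f + A w`, equals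
`det (B + T(w))` times `c (B + T(w)) - A + T(·, y, ·)`. -/
def pencil (B : Matrix (Fin n) (Fin n) R) (T : Fin n → Fin n → Fin n → R)
    (A : Matrix (Fin n) (Fin n) R) (f : Fin n → R) (c : R) (w : Fin n → R) :
    Matrix (Fin n) (Fin n) R :=
  Matrix.of fun i k => (affineForm B T w).det * (c * affineForm B T w i k - A i k) +
    ∑ j, T i j k * ((affineForm B T w).adjugate *ᵥ (f + A *ᵥ w)) j

theorem map_affineForm (φ : R →+* S) (B : Matrix (Fin n) (Fin n) R)
    (T : Fin n → Fin n → Fin n → R) (w : Fin n → R) :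
    φ.mapMatrix (affineForm B T w) =
      affineForm (φ.mapMatrix B) (fun i j k => φ (T i j k)) (φ ∘ w) := by
  ext i j
  simp [affineForm]

theorem map_det_pencil (φ : R →+* S) (B : Matrix (Fin n) (Fin n) R)
    (T : Fin n → Fin n → Fin n → R) (A : Matrix (Fin n) (Fin n) R) (f : Fin n → R) (c : R)
    (w : Fin n → R) :
    φ (pencil B T A f c w).det = (pencil (φ.mapMatrix B) (fun i j k => φ (T i j k))
      (φ.mapMatrix A) (φ ∘ f) (φ c) (φ ∘ w)).det := by
  rw [φ.map_det]
  congr 1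
  ext i k
  have h : ∀ (M : Matrix (Fin n) (Fin n) R) (x : Fin n → R) (j : Fin n),
      φ ((M *ᵥ x) j) = (φ.mapMatrix M *ᵥ (φ ∘ x)) j := fun M x j => φ.map_mulVec M x j
  have h2 : φ ∘ (f + A *ᵥ w) = φ ∘ f + φ.mapMatrix A *ᵥ (φ ∘ w) := by
    ext j
    simp [h]
  change φ (pencil B T A f c w i k) = _
  simp only [pencil, ← map_affineForm, Matrix.of_apply, map_add φ, map_mul, map_sub φ, map_sum φ]
  simp only [h, h2, RingHom.map_adjugate, φ.map_det]
  rfl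

theorem pencil_eq {B : Matrix (Fin n) (Fin n) R} {T : Fin n → Fin n → Fin n → R}
    {A : Matrix (Fin n) (Fin n) R} {f : Fin n → R} (c : R) {w y : Fin n → R}
    (hy : affineForm B T w *ᵥ y = f + A *ᵥ w) :
    pencil B T A f c w = (affineForm B T w).det •
      (c • affineForm B T w - (A - Matrix.of fun i k => ∑ j, T i j k * y j)) := by
  have h : (affineForm B T w).adjugate *ᵥ (f + A *ᵥ w) = (affineForm B T w).det • y := by
    rw [← hy, Matrix.mulVec_mulVec, Matrix.adjugate_mul, Matrix.smul_mulVec, Matrix.one_mulVec]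
  ext i k
  simp only [pencil, h, Matrix.of_apply, Matrix.smul_apply, Matrix.sub_apply, smul_eq_mul,
    Pi.smul_apply]
  have hs : ∑ j, T i j k * ((affineForm B T w).det * y j) =
      (affineForm B T w).det * ∑ j, T i j k * y j := by
    rw [Finset.mul_sum]
    exact Finset.sum_congr rfl fun j _ => by ring
  rw [hs]
  ring

/-- The pencil factors as det(H) · H (c - W) with H = B + T(w): the scalar contributes n powers of
det H, the factor H one more. -/
theorem det_pencil_eq {B : Matrix (Fin n) (Fin n) R} {T : Fin n → Fin n → Fin n → R}
    {A W : Matrix (Fin n) (Fin n) R} {f : Fin n → R} (c : R) {w y : Fin n → R}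
    (hy : affineForm B T w *ᵥ y = f + A *ᵥ w)
    (hW : affineForm B T w * W = A - Matrix.of fun i k => ∑ j, T i j k * y j) :
    (pencil B T A f c w).det = (affineForm B T w).det ^ (n + 1) * W.charpoly.eval c := by
  have h : c • affineForm B T w - affineForm B T w * W =
      affineForm B T w * (Matrix.scalar (Fin n) c - W) := by
    rw [Matrix.mul_sub, Matrix.scalar_apply, ← Matrix.smul_one_eq_diagonal, Matrix.mul_smul,
      Matrix.mul_one]
  rw [pencil_eq c hy, ← hW, h, Matrix.det_smul, Matrix.det_mul, Matrix.eval_charpoly,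
    Fintype.card_fin]
  ring

/-- The vector r lies in the kernel of the pencil for every t. Being purely algebraic, the argument
applies to complex r and to t with B + T(tr) singular. -/
theorem det_pencil_line_eq_zero [IsDomain R] {B : Matrix (Fin n) (Fin n) R}
    {T : Fin n → Fin n → Fin n → R}
    {A W : Matrix (Fin n) (Fin n) R} {c : R} {y r : Fin n → R} (hT : ∀ i j k, T i j k = -T i k j)
    (h2 : (2 : R) ≠ 0)
    (hW : B * W = A - Matrix.of fun i k => ∑ j, T i j k * y j) (hr : r ≠ 0)
    (hWr : W *ᵥ r = c • r) (t : R) : (pencil B T A (B *ᵥ y) c (t • r)).det = 0 := by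
  have hTrr : ∀ i, ∑ j, ∑ k, T i j k * r k * r j = 0 := by
    intro i
    have h : ∑ j, ∑ k, T i j k * r k * r j = -∑ j, ∑ k, T i j k * r k * r j := by
      conv_lhs => rw [Finset.sum_comm]
      rw [← Finset.sum_neg_distrib]
      refine Finset.sum_congr rfl fun j _ => ?_
      rw [← Finset.sum_neg_distrib]
      refine Finset.sum_congr rfl fun k _ => ?_
      rw [hT]
      ring
    have h' : (2 : R) * ∑ j, ∑ k, T i j k * r k * r j = 0 := by linear_combination h
    exact (mul_eq_zero.1 h').resolve_left h2
  have hτ : ∀ x : Fin n → R, (Matrix.of fun i j => ∑ k, T i j k * r k) *ᵥ x =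
      (Matrix.of fun i k => ∑ j, T i j k * x j) *ᵥ r := by
    intro x
    ext i
    simp only [Matrix.mulVec, dotProduct, Matrix.of_apply, Finset.sum_mul]
    rw [Finset.sum_comm]
    exact Finset.sum_congr rfl fun j _ => Finset.sum_congr rfl fun k _ => by ring
  have hTr : (Matrix.of fun i j => ∑ k, T i j k * r k) *ᵥ r = 0 := by
    ext i
    simpa [Matrix.mulVec, dotProduct, Finset.sum_mul] using hTrr i
  have hAr : c • (B *ᵥ r) = A *ᵥ r - (Matrix.of fun i j => ∑ k, T i j k * r k) *ᵥ y := by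
    rw [hτ, ← Matrix.sub_mulVec, ← hW, ← Matrix.mulVec_mulVec, hWr, Matrix.mulVec_smul]
  have haff : affineForm B T (t • r) = B + t • Matrix.of fun i j => ∑ k, T i j k * r k := by
    ext i j
    simp only [affineForm, Matrix.add_apply, Matrix.of_apply, Matrix.smul_apply, Pi.smul_apply,
      smul_eq_mul, Finset.mul_sum]
    congr 1
    exact Finset.sum_congr rfl fun k _ => by ring
  -- The solution is affine in t: the t² term contains T(r)r = 0, and the t term is `hAr`.
  have hy : affineForm B T (t • r) *ᵥ (y + (c * t) • r) = B *ᵥ y + A *ᵥ (t • r) := by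
    rw [haff, Matrix.add_mulVec, Matrix.smul_mulVec, Matrix.mulVec_add, Matrix.mulVec_add,
      Matrix.mulVec_smul, Matrix.mulVec_smul, Matrix.mulVec_smul, hTr, mul_comm c t, mul_smul,
      hAr]
    module
  refine Matrix.exists_mulVec_eq_zero_iff.1 ⟨r, hr, ?_⟩
  rw [pencil_eq c hy, Matrix.smul_mulVec, Matrix.sub_mulVec, Matrix.sub_mulVec, ← hτ,
    Matrix.smul_mulVec, haff, Matrix.add_mulVec, Matrix.smul_mulVec, Matrix.mulVec_add,
    Matrix.mulVec_smul, hTr, smul_zero, smul_zero, add_zero, add_zero, hAr, sub_self, smul_zero]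

end Pencil

/-! ### Leading coefficients and continuity of characteristic polynomials -/

section Asymptotics

open Polynomial Filter Topology

theorem coeff_eq_of_tendsto {α : Type*} {l : Filter α} [l.NeBot] {x : α → ℂ}
    (hx : Tendsto x l (𝓝 0)) (hx0 : ∀ᶠ a in l, x a ≠ 0) (m : ℕ) :
    ∀ {Q : ℂ[X]} {L : ℂ}, Tendsto (fun a => Q.eval (x a) / x a ^ m) l (𝓝 L) →
      Q.coeff m = L := by
  induction m with
  | zero =>
    intro Q L h
    have h1 : Tendsto (fun a => Q.eval (x a)) l (𝓝 (Q.eval 0)) :=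
      Q.continuous.continuousAt.tendsto.comp hx
    simp only [pow_zero, div_one] at h
    rw [coeff_zero_eq_eval_zero]
    exact tendsto_nhds_unique h1 h
  | succ m ih =>
    intro Q L h
    have h0 : Q.coeff 0 = 0 := by
      have h1 : Tendsto (fun a => Q.eval (x a)) l (𝓝 (Q.eval 0)) :=
        Q.continuous.continuousAt.tendsto.comp hx
      have h2 := h.mul (hx.pow (m + 1))
      rw [zero_pow (Nat.succ_ne_zero m), mul_zero] at h2
      rw [coeff_zero_eq_eval_zero]
      refine tendsto_nhds_unique h1 (h2.congr' ?_)
      filter_upwards [hx0] with a ha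
      exact div_mul_cancel₀ _ (pow_ne_zero _ ha)
    rw [← coeff_divX]
    refine ih (h.congr' ?_)
    filter_upwards [hx0] with a ha
    conv_lhs => rw [← divX_mul_X_add Q, h0]
    simp only [map_zero, add_zero, eval_mul, eval_X]
    rw [pow_succ, mul_div_mul_right _ _ ha]

/-- The cofactor is written with Taylor coefficients, rather than as a quotient, so that it depends
visibly continuously on p and a. -/
theorem eval_eq_pow_mul_sum_taylor {p : ℂ[X]} {a : ℂ} {m n : ℕ} (hm : m ≤ p.rootMultiplicity a)
    (hn : p.natDegree ≤ n) (b : ℂ) :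
    p.eval b = (b - a) ^ m * ∑ k ∈ Finset.range (n + 1), (taylor a p).coeff (m + k) * (b - a) ^ k := by
  have h1 : p.eval b = (taylor a p).eval (b - a) := by
    rw [taylor_eval_sub]
  rw [rootMultiplicity_eq_natTrailingDegree] at hm
  rw [h1, eval_eq_sum_range' (n := m + (n + 1)) (by rw [natDegree_taylor]; omega),
    Finset.sum_range_add, Finset.sum_eq_zero, zero_add, Finset.mul_sum]
  · exact Finset.sum_congr rfl fun k _ => by ring
  · intro k hk
    have : (taylor a p).coeff k = 0 :=
      coeff_eq_zero_of_lt_natTrailingDegree ((Finset.mem_range.1 hk).trans_le hm)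
    rw [this, zero_mul]

theorem taylor_coeff_rootMultiplicity_ne_zero {p : ℂ[X]} (hp : p ≠ 0) (a : ℂ) :
    (taylor a p).coeff (p.rootMultiplicity a) ≠ 0 := by
  rw [rootMultiplicity_eq_natTrailingDegree]
  have : taylor a p ≠ 0 := by simpa using hp
  exact trailingCoeff_nonzero_iff_nonzero.2 this

theorem tendsto_taylor_coeff {α : Type*} {l : Filter α} {p : α → ℂ[X]} {a : α → ℂ} {p₀ : ℂ[X]}
    {a₀ : ℂ} {n : ℕ} (hn : ∀ x, (p x).natDegree ≤ n) (hn₀ : p₀.natDegree ≤ n)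
    (hp : ∀ i, Tendsto (fun x => (p x).coeff i) l (𝓝 (p₀.coeff i))) (ha : Tendsto a l (𝓝 a₀))
    (k : ℕ) : Tendsto (fun x => (taylor (a x) (p x)).coeff k) l (𝓝 ((taylor a₀ p₀).coeff k)) := by
  have h : ∀ (q : ℂ[X]) (b : ℂ), q.natDegree ≤ n → (taylor b q).coeff k =
      ∑ i ∈ Finset.range (n + 1), ((i + k).choose k : ℂ) * q.coeff (i + k) * b ^ i := by
    intro q b hq
    rw [taylor_coeff, eval_eq_sum_range' (n := n + 1)
      (((natDegree_hasseDeriv_le q k).trans (Nat.sub_le _ _)).trans_lt (by omega))]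
    simp only [hasseDeriv_coeff]
  rw [h p₀ a₀ hn₀]
  simp only [fun x => h (p x) (a x) (hn x)]
  exact tendsto_finsetSum _ fun i _ => ((hp (i + k)).const_mul _).mul (ha.pow i)

theorem tendsto_charpoly_coeff {α : Type*} {l : Filter α} {n : ℕ}
    {M : α → Matrix (Fin n) (Fin n) ℂ} {M₀ : Matrix (Fin n) (Fin n) ℂ}
    (hM : ∀ i j, Tendsto (fun x => M x i j) l (𝓝 (M₀ i j))) (k : ℕ) :
    Tendsto (fun x => (M x).charpoly.coeff k) l (𝓝 (M₀.charpoly.coeff k)) := by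
  have h : ∀ N : Matrix (Fin n) (Fin n) ℂ, N.charpoly.coeff k =
      MvPolynomial.eval (fun q : Fin n × Fin n => N q.1 q.2)
        ((Matrix.charpoly.univ ℂ (Fin n)).coeff k) := by
    intro N
    exact (Matrix.charpoly.univ_coeff_eval₂Hom (Fin n) (RingHom.id ℂ)
      (fun q : Fin n × Fin n => N q.1 q.2) k).symm
  simp only [h]
  exact (MvPolynomial.continuous_eval _).continuousAt.tendsto.comp
    (tendsto_pi_nhds.2 fun q => hM q.1 q.2)

end Asymptotics

/-! ### Linear degeneracy at points of minimal multiplicity -/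

section LinearDegeneracy

open Polynomial Filter Topology

/-- The outer variable is the parameter t and the inner ones are the direction w, so each
coefficient of a power of t is itself a polynomial in the direction. -/
theorem exists_polynomial_eval_eq_det_pencil {n : ℕ} (B : Matrix (Fin n) (Fin n) ℂ)
    (T : Fin n → Fin n → Fin n → ℂ) (A : Matrix (Fin n) (Fin n) ℂ) (f : Fin n → ℂ) (c : ℂ) :
    ∃ D : (MvPolynomial (Fin n) ℂ)[X], ∀ (w : Fin n → ℂ) (t : ℂ),
      (D.map (MvPolynomial.eval w)).eval t = (pencil B T A f c (t • w)).det := by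
  let ι : ℂ →+* (MvPolynomial (Fin n) ℂ)[X] := Polynomial.C.comp MvPolynomial.C
  refine ⟨(pencil (ι.mapMatrix B) (fun i j k => ι (T i j k)) (ι.mapMatrix A) (ι ∘ f) (ι c)
    (fun i => Polynomial.C (MvPolynomial.X i) * Polynomial.X)).det, fun w t => ?_⟩
  let φ : (MvPolynomial (Fin n) ℂ)[X] →+* ℂ :=
    (evalRingHom t).comp (mapRingHom (MvPolynomial.eval w))
  have hι : ∀ z, φ (ι z) = z := fun z => by simp [φ, ι]
  have hM : ∀ M : Matrix (Fin n) (Fin n) ℂ, φ.mapMatrix (ι.mapMatrix M) = M := by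
    intro M
    ext i j
    exact hι _
  have hw : φ ∘ (fun i => Polynomial.C (MvPolynomial.X i) * Polynomial.X) = t • w := by
    ext i
    change eval t (Polynomial.map (MvPolynomial.eval w)
      (Polynomial.C (MvPolynomial.X i) * Polynomial.X)) = t * w i
    rw [Polynomial.map_mul, map_C, map_X, eval_mul, eval_C, eval_X, MvPolynomial.eval_X, mul_comm]
  change φ _ = _
  rw [map_det_pencil, hM, hM, hι, hw]
  simp only [hι]
  congr 2
  ext i
  exact hι _

variable {𝕜 : Type*} [RCLike 𝕜] [NormedAlgebra 𝕜 ℂ] {n : ℕ}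
  {g : (Fin n → 𝕜) → Matrix (Fin n) (Fin n) 𝕜} {V : (Fin n → 𝕜) → Fin n → 𝕜}
  {Ω : Set (Fin n → 𝕜)}

/-- The characteristic polynomial at `c` of the velocity matrix is, up to a power of
`det g⁻¹`, a polynomial function near `v`. -/
theorem IsCompatible.exists_polynomial (hΩ : IsOpen Ω) (hg : IsSecondOrderHHO g Ω)
    (hV : ContDiffOn 𝕜 ∞ V Ω) (hc : IsCompatible g V Ω) {v : Fin n → 𝕜} (hv : v ∈ Ω)
    (c : ℂ) {r : Fin n → ℂ} (hr : r ≠ 0)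
    (hWr : (velocityMatrix V v).map (algebraMap 𝕜 ℂ) *ᵥ r = c • r) :
    ∃ D : (MvPolynomial (Fin n) ℂ)[X],
      (∀ t, (D.map (MvPolynomial.eval r)).eval t = 0) ∧
      ∀ᶠ u in 𝓝 v, ∀ (z : Fin n → 𝕜) (s : 𝕜), u = v + s • z →
        (D.map (MvPolynomial.eval (algebraMap 𝕜 ℂ ∘ z))).eval (algebraMap 𝕜 ℂ s) =
          algebraMap 𝕜 ℂ ((g u)⁻¹.det) ^ (n + 1) *
            ((velocityMatrix V u).map (algebraMap 𝕜 ℂ)).charpoly.eval c := by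
  obtain ⟨ε, hε, hball⟩ := Metric.isOpen_iff.1 hΩ v hv
  obtain ⟨T, A, hT, h⟩ := hc.exists_affine hΩ hg hV hε hball
  set σ := algebraMap 𝕜 ℂ with hσ
  have hcomp : ∀ (M : Matrix (Fin n) (Fin n) 𝕜) (x : Fin n → 𝕜),
      σ.mapMatrix M *ᵥ (σ ∘ x) = σ ∘ (M *ᵥ x) := by
    intro M x
    ext i
    exact (σ.map_mulVec M x i).symm
  have hτ : ∀ y : Fin n → 𝕜, (Matrix.of fun i k => ∑ j, σ (T i j k) * (σ ∘ y) j) =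
      σ.mapMatrix (Matrix.of fun i k => ∑ j, T i j k * y j) := by
    intro y
    ext i k
    simp
  obtain ⟨D, hD⟩ := exists_polynomial_eval_eq_det_pencil (σ.mapMatrix (g v)⁻¹)
    (fun i j k => σ (T i j k)) (σ.mapMatrix A) (σ ∘ ((g v)⁻¹ *ᵥ V v)) c
  refine ⟨D, fun t => ?_, ?_⟩
  · rw [hD, ← hcomp]
    refine det_pencil_line_eq_zero (W := σ.mapMatrix (velocityMatrix V v)) ?_ two_ne_zero ?_ hr
      hWr t
    · intro i j k
      rw [hT, map_neg]
    · rw [hτ, ← map_mul, (h v (Metric.mem_ball_self hε)).2.2, map_sub]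
  · filter_upwards [Metric.ball_mem_nhds v hε] with u hu z s hus
    obtain ⟨h1, h2, h3⟩ := h u hu
    have hsz : σ s • (σ ∘ z) = σ ∘ (u - v) := by
      ext i
      simp [hus]
    have haff : affineForm (σ.mapMatrix (g v)⁻¹) (fun i j k => σ (T i j k)) (σ ∘ (u - v)) =
        σ.mapMatrix (g u)⁻¹ := by
      rw [← map_affineForm, h1]
      rfl
    rw [hD, hsz, det_pencil_eq (W := σ.mapMatrix (velocityMatrix V u)) (y := σ ∘ V u) c, haff,
      ← RingHom.map_det]
    · rfl
    · rw [haff, hcomp, h2, hcomp]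
      ext i
      simp
    · rw [haff, hτ, ← map_mul, h3, map_sub]

theorem IsCompatible.exists_mem_fderiv_eq_zero (hΩ : IsOpen Ω) (hg : IsSecondOrderHHO g Ω)
    (hV : ContDiffOn 𝕜 ∞ V Ω) (hc : IsCompatible g V Ω) {U : Set (Fin n → 𝕜)} (hU : IsOpen U)
    (hUΩ : U ⊆ Ω) (hne : U.Nonempty) {lam : (Fin n → 𝕜) → ℂ} {r : (Fin n → 𝕜) → Fin n → ℂ}
    (hlam : ContDiffOn 𝕜 1 lam U)
    (hr : ∀ u ∈ U, r u ≠ 0 ∧ (velocityMatrix V u).map (algebraMap 𝕜 ℂ) *ᵥ r u = lam u • r u) :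
    ∃ v ∈ U, ∑ i, r v i * fderiv 𝕜 lam v (Pi.single i 1) = 0 := by
  set σ := algebraMap 𝕜 ℂ with hσ
  have hσc : Continuous σ := continuous_algebraMap 𝕜 ℂ
  let p : (Fin n → 𝕜) → ℂ[X] := fun u => ((velocityMatrix V u).map σ).charpoly
  have hpn : ∀ u, (p u).natDegree ≤ n := fun u => by
    simp [p, Matrix.charpoly_natDegree_eq_dim]
  have hp0 : ∀ u, p u ≠ 0 := fun u => (Matrix.charpoly_monic _).ne_zero
  let μ : (Fin n → 𝕜) → ℕ := fun u => (p u).rootMultiplicity (lam u)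
  -- Minimality makes (X - λ(u))ᵐ divide the characteristic polynomial at every u in U, with m exact
  -- at v.
  obtain ⟨v, hv, hmin⟩ : ∃ v ∈ U, ∀ u ∈ U, μ v ≤ μ u := by
    obtain ⟨_, ⟨v, hv, rfl⟩, h⟩ := WellFounded.has_min Nat.lt_wfRel.wf (μ '' U) (hne.image μ)
    exact ⟨v, hv, fun u hu => not_lt.1 (h _ ⟨u, hu, rfl⟩)⟩
  refine ⟨v, hv, ?_⟩
  set m := μ v with hm
  have hvΩ := hUΩ hv
  have hlv : HasFDerivAt lam (fderiv 𝕜 lam v) v :=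
    ((hlam.contDiffAt (hU.mem_nhds hv)).differentiableAt (by simp)).hasFDerivAt
  obtain ⟨D, hD0, hD⟩ := hc.exists_polynomial hΩ hg hV hvΩ (lam v) (hr v hv).1 (hr v hv).2
  let q : (Fin n → 𝕜) → ℂ := fun u =>
    ∑ k ∈ Finset.range (n + 1), (taylor (lam u) (p u)).coeff (m + k) * (lam v - lam u) ^ k
  have hpq : ∀ u ∈ U, (p u).eval (lam v) = (lam v - lam u) ^ m * q u := fun u hu =>
    eval_eq_pow_mul_sum_taylor (hmin u hu) (hpn u) _
  have hqv : q v ≠ 0 := by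
    have : q v = (taylor (lam v) (p v)).coeff m := by
      simp only [q, sub_self]
      rw [Finset.sum_range_succ', Finset.sum_eq_zero (fun k _ => by simp)]
      simp
    rw [this]
    exact taylor_coeff_rootMultiplicity_ne_zero (hp0 v) _
  have hqc : Tendsto q (𝓝 v) (𝓝 (q v)) := by
    refine tendsto_finsetSum _ fun k _ => (tendsto_taylor_coeff hpn (hpn v) (fun i => ?_)
      hlv.continuousAt.tendsto _).mul ((tendsto_const_nhds.sub hlv.continuousAt.tendsto).pow k)
    refine tendsto_charpoly_coeff (fun a b => ?_) i
    exact (hσc.tendsto _).comp (contDiffAt_velocityMatrix (hV.contDiffAt (hΩ.mem_nhds hvΩ))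
      a b).continuousAt.tendsto
  set d : ℂ := σ ((g v)⁻¹.det) with hd
  have hd0 : d ≠ 0 := by
    rw [hd, _root_.map_ne_zero, Matrix.det_nonsing_inv, Ring.inverse_eq_inv']
    exact inv_ne_zero (hg.nondegenerate v hvΩ)
  have hdc : Tendsto (fun u => σ ((g u)⁻¹.det)) (𝓝 v) (𝓝 d) :=
    (hσc.tendsto _).comp ((contDiffOn_det (contDiffOn_inv hg.smooth hg.nondegenerate)).contDiffAt
      (hΩ.mem_nhds hvΩ)).continuousAt.tendsto
  have hcoeff : ∀ z : Fin n → 𝕜, MvPolynomial.eval (σ ∘ z) (D.coeff m) =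
      d ^ (n + 1) * q v * (-fderiv 𝕜 lam v z) ^ m := by
    intro z
    rw [← coeff_map]
    have hline : Tendsto (fun s : 𝕜 => v + s • z) (𝓝[≠] 0) (𝓝 v) := by
      have : Continuous fun s : 𝕜 => v + s • z := by fun_prop
      exact (this.tendsto' 0 v (by simp)).mono_left nhdsWithin_le_nhds
    have hs0 : Tendsto (fun s : 𝕜 => σ s) (𝓝[≠] 0) (𝓝 0) :=
      (hσc.tendsto' 0 0 (map_zero σ)).mono_left nhdsWithin_le_nhds
    refine coeff_eq_of_tendsto hs0 ?_ m (L := d ^ (n + 1) * q v * (-fderiv 𝕜 lam v z) ^ m) ?_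
    · filter_upwards [self_mem_nhdsWithin] with s hs
      exact (_root_.map_ne_zero σ).2 hs
    · have hslope : Tendsto (fun s : 𝕜 => (lam v - lam (v + s • z)) / σ s) (𝓝[≠] 0)
          (𝓝 (-fderiv 𝕜 lam v z)) := by
        have h1 := hlv.hasLineDerivAt z
        have h2 := (hasDerivAt_iff_tendsto_slope.1 h1).neg
        refine h2.congr fun s => ?_
        rw [slope_def_module, Algebra.smul_def]
        simp only [sub_zero, zero_smul, add_zero, map_inv₀, ← hσ]
        rw [inv_mul_eq_div, ← neg_div, neg_sub]
      have h3 := (((hdc.comp hline).pow (n + 1)).mul (hqc.comp hline)).mul (hslope.pow m)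
      refine h3.congr' ?_
      filter_upwards [hline.eventually hD, hline.eventually (hU.mem_nhds hv)] with s h4 h5
      rw [h4 z s rfl]
      have h6 := hpq _ h5
      simp only [p] at h6
      rw [h6]
      simp only [Function.comp_apply, div_pow]
      ring
  -- The limits determine this coefficient only for directions in 𝕜ⁿ. The image of 𝕜 in ℂ is
  -- infinite, so the identity extends to all complex directions, in particular to r.
  have hpoly : D.coeff m = MvPolynomial.C (d ^ (n + 1) * q v) *
      (-∑ i, MvPolynomial.X i * MvPolynomial.C (fderiv 𝕜 lam v (Pi.single i 1))) ^ m := by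
    refine MvPolynomial.funext_set (fun _ => Set.range σ)
      (fun _ => Set.infinite_range_of_injective σ.injective) fun x hx => ?_
    obtain ⟨z, rfl⟩ : ∃ z : Fin n → 𝕜, σ ∘ z = x := by
      choose z hz using fun i => hx i (Set.mem_univ i)
      exact ⟨z, funext hz⟩
    rw [hcoeff, clm_eq_sum]
    simp [Algebra.smul_def, hσ]
  have hDr : D.map (MvPolynomial.eval (r v)) = 0 := Polynomial.funext fun t => by
    rw [hD0, eval_zero]
  have h0 : MvPolynomial.eval (r v) (D.coeff m) = 0 := by
    rw [← coeff_map, hDr, coeff_zero]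
  rw [hpoly] at h0
  simp only [map_mul, map_pow, map_neg, map_sum, MvPolynomial.eval_C, MvPolynomial.eval_X] at h0
  have h1 := (mul_eq_zero.1 h0).resolve_left (mul_ne_zero (pow_ne_zero _ hd0) hqv)
  exact neg_eq_zero.1 (by_contra fun hne => pow_ne_zero _ hne h1)

end LinearDegeneracy

end HHO

theorem corollary3p7 {𝕜 : Type*} [RCLike 𝕜] [NormedAlgebra 𝕜 ℂ] {n : ℕ}
    (Ω : Set (Fin n → 𝕜)) (hΩ : IsOpen Ω)
    (g : (Fin n → 𝕜) → Matrix (Fin n) (Fin n) 𝕜) (hg : HHO.IsSecondOrderHHO g Ω)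
    (V : (Fin n → 𝕜) → Fin n → 𝕜) (hV : ContDiffOn 𝕜 ∞ V Ω)
    (hc : HHO.IsCompatible g V Ω) :
    HHO.IsLinearlyDegenerate V Ω := by
  intro U hU hUΩ lam r hlam hrc hr
  by_contra! h
  obtain ⟨u, hu, hne⟩ := h
  have hcont : ContinuousOn (fun u => ∑ i, r u i * fderiv 𝕜 lam u (Pi.single i 1)) U := by
    refine continuousOn_finsetSum _ fun i _ => ?_
    exact (continuousOn_pi.1 hrc i).mul
      ((hlam.continuousOn_fderiv_of_isOpen hU le_rfl).clm_apply continuousOn_const)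
  -- The set where the expression is nonzero is open, so the existence result can be applied to it
  -- in place of U.
  have hopen := hcont.isOpen_inter_preimage hU (isOpen_ne (x := (0 : ℂ)))
  obtain ⟨v, hv, hv0⟩ := hc.exists_mem_fderiv_eq_zero hΩ hg hV hopen
    (Set.inter_subset_left.trans hUΩ) ⟨u, hu, hne⟩ (hlam.mono Set.inter_subset_left)
    (fun w hw => hr w hw.1)
  exact hv.2 hv0
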